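/- Let $R$ be a commutative ring with unit, $\delta\in R$ and $n\ge 0$. The Brauer algebra $\mathrm{Br}_n(\delta)$ is the $R$-algebra whose basis consists of the diagrams, i.e. the partitions of $\{1,\dots,n\}\cup\{1',\dots,n'\}$ into two-element parts, multiplied by concatenation, each closed loop being replaced by a factor $\delta$. A left-to-right connection of a diagram is a part that contains both an unprimed and a primed element. A link state with $t$ defects is a partition of $\{1,\dots,n\}$ into parts of size $1$ or $2$, exactly $t$ of them of size $1$; the elements of the parts of size $1$ are called defects. For link states $p,q$ with $t$ defects and $\sigma\in\Sigma_t$, let $C^\sigma_{p,q}$ be the diagram that consists of the two-element parts of $p$, of the primed copies of the two-element parts of $q$, and of the pairs joining, for each $1\le i\le t$, the $\sigma(i)$-th defect of $p$ to the primed copy of the $i$-th defect of $q$. Let $A\subseteq \mathrm{Br}_n(\delta)$ be a (unital) subalgebra obtained by restriction: for each $t$ there are given a (possibly empty) set $M(t)$ of link states with $t$ defects and a subgroup $G(t)\le\Sigma_t$, such that the diagrams $C^\sigma_{p,q}$ with $p,q\in M(t)$, $\sigma\in G(t)$, for all $t$, form an $R$-basis of $A$. For an integer $a$ let $I_{\le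 a}\subseteq A$ be the two-sided ideal spanned over $R$ by those of these basis diagrams that have at most $a$ left-to-right connections (so $I_{\le a}=0$ if $a<0$). The trivial module $\mathbb 1$ is $R$, on which diagrams with $n$ left-to-right connections act as $1$ and all other diagrams act as $0$; for $a\le n-1$ it is a left and right module over $A/I_{\le a}$. For link states $q,p$ with $t$ defects, the pair graph $\Gamma_{\langle q,p\rangle}$ is the graph on $\{1,\dots,n\}$ whose edges are the two-element parts of $q$ and those of $p$, and the pair set $S_{\langle q,p\rangle}$ is the set of its connected components that contain a defect of $q$ and a defect of $p$. For $0\le t\le n-1$, the algebra $A$ satisfies Hypothesis $(\dagger)$ at $t$ if for every $q\in M(t)$ there exists $p\in M(t)$ such that $|S_{\langle q,p\rangle}|=t$ and $\delta^{i}$ is invertible in $R$, where $i$ is the number of connected components of $\Gamma_{\langle q,p\rangle}$ that contain neither a defect of $q$ nor a defect of $p$. **Theorem.** Let $a\le b\le n-1$ be integers such that $A$ satisfies Hypothesis $(\dagger)$ at every integer $t\ge 0$ with $a<t\le b$. Then the quotient map $A/I_{\le a}\to A/I_{\le b}$ induces an isomorphism of $R$-modules $$\mathrm{Tor}_i^{A/I_{\le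 a}}(\mathbb 1,\mathbb 1)\;\cong\;\mathrm{Tor}_i^{A/I_{\le b}}(\mathbb 1,\mathbb 1)$$ for every $i\ge 0$. -/

import Mathlib

namespace Brauer

section Concatenation

variable {V T U P X Y Z W : Type*}

/-- The number of classes of `E` that do not meet the image of `k`. -/
noncomputable def missing (E : Setoid V) (k : T → V) : ℕ :=
  {c : Quotient E | ∀ t, Quotient.mk E (k t) ≠ c}.ncard

/-- Stack a partition `d` of `X ⊕ Y` and a partition `e` of `Y ⊕ Z` along the common middle row `Y`:
the finest partition of the three rows for which elements that share a part of `d`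
or of `e` are together. -/
def glue (d : Setoid (X ⊕ Y)) (e : Setoid (Y ⊕ Z)) : Setoid (X ⊕ (Y ⊕ Z)) :=
  d.map (Sum.map id Sum.inl) ⊔ e.map Sum.inr

/-- The inclusion of the two outer rows. -/
def outer : X ⊕ Z → X ⊕ (Y ⊕ Z) := Sum.map id Sum.inr

/-- The partition of the outer rows left after concatenation. -/
def concat (d : Setoid (X ⊕ Y)) (e : Setoid (Y ⊕ Z)) : Setoid (X ⊕ Z) :=
  (glue d e).comap outer

/-- The number of loops of a concatenation: the components inside the middle row. -/
noncomputable def loops (d : Setoid (X ⊕ Y)) (e : Setoid (Y ⊕ Z)) : ℕ :=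
  missing (glue d e) outer

theorem map_le_iff (s : Setoid U) (l : U → V) (E : Setoid V) :
    s.map l ≤ E ↔ s ≤ E.comap l := by
  constructor
  · intro h x y hxy
    exact h (Setoid.le_comap_map hxy)
  · intro h
    refine Setoid.eqvGen_le ?_
    rintro _ _ ⟨x, y, hxy, rfl, rfl⟩
    exact h hxy

theorem map_rel {l : U → V} (hl : l.Injective) (s : Setoid U) (x y : V) :
    s.map l x y ↔ x = y ∨ ∃ u v, s u v ∧ l u = x ∧ l v = y := by
  constructor
  · intro h
    let P : Setoid V :=
      { r := fun x y => x = y ∨ ∃ u v, s u v ∧ l u = x ∧ l v = y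
        iseqv :=
          { refl := fun x => Or.inl rfl
            symm := by
              rintro x y (rfl | ⟨u, v, h, rfl, rfl⟩)
              · exact Or.inl rfl
              · exact Or.inr ⟨v, u, s.symm' h, rfl, rfl⟩
            trans := by
              rintro x y z (rfl | ⟨u, v, h, rfl, rfl⟩) (rfl | ⟨u', v', h', hu, rfl⟩)
              · exact Or.inl rfl
              · exact Or.inr ⟨u', v', h', hu, rfl⟩
              · exact Or.inr ⟨u, v, h, rfl, rfl⟩
              · obtain rfl := hl hu
                exact Or.inr ⟨u, v', s.trans' h h', rfl, rfl⟩ } }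
    exact (map_le_iff s l P).2 (fun u v h => Or.inr ⟨u, v, h, rfl, rfl⟩) h
  · rintro (rfl | ⟨u, v, h, rfl, rfl⟩)
    · exact Setoid.refl' _ _
    · exact Setoid.le_comap_map h

theorem map_map_eq (s : Setoid U) (l : U → V) (m : V → W) :
    (s.map l).map m = s.map (m ∘ l) := by
  refine eq_of_forall_ge_iff fun E => ?_
  rw [map_le_iff, map_le_iff, map_le_iff, Setoid.comap_comp]

theorem map_sup_eq (s t : Setoid U) (l : U → V) :
    (s ⊔ t).map l = s.map l ⊔ t.map l := by
  refine eq_of_forall_ge_iff fun E => ?_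
  simp only [map_le_iff, sup_le_iff]

theorem comap_sup_eq (A B : Setoid V) (k : T → V)
    (hB : ∀ x y, B x y → x = y ∨ (x ∈ Set.range k ∧ y ∈ Set.range k)) :
    (A ⊔ B).comap k = A.comap k ⊔ B.comap k := by
  apply le_antisymm
  · intro a b hab
    let P : V → Prop := fun x => ∃ t, (A.comap k ⊔ B.comap k) a t ∧ A (k t) x
    have hA : A ≤ Setoid.ker P := by
      intro x y hxy
      refine propext ⟨?_, ?_⟩
      · rintro ⟨t, h, h'⟩; exact ⟨t, h, A.trans' h' hxy⟩
      · rintro ⟨t, h, h'⟩; exact ⟨t, h, A.trans' h' (A.symm' hxy)⟩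
    have key : ∀ s s', B (k s) (k s') → P (k s) → P (k s') := by
      rintro s s' h ⟨t, h1, h2⟩
      refine ⟨s', ?_, A.refl' _⟩
      have h3 : (A.comap k ⊔ B.comap k) t s := (le_sup_left : A.comap k ≤ _) h2
      have h4 : (A.comap k ⊔ B.comap k) s s' := (le_sup_right : B.comap k ≤ _) h
      exact Setoid.trans' _ (Setoid.trans' _ h1 h3) h4
    have hB' : B ≤ Setoid.ker P := by
      intro x y hxy
      rcases hB x y hxy with rfl | ⟨⟨s, rfl⟩, ⟨s', rfl⟩⟩
      · rfl
      · exact propext ⟨key s s' hxy, key s' s (B.symm' hxy)⟩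
    have h : P (k a) = P (k b) := (sup_le hA hB') hab
    have h0 : P (k a) := ⟨a, Setoid.refl' _ _, A.refl' _⟩
    rw [h] at h0
    obtain ⟨t, h1, h2⟩ := h0
    exact Setoid.trans' _ h1 ((le_sup_left : A.comap k ≤ _) h2)
  · refine sup_le ?_ ?_
    · intro x y h; exact (le_sup_left : A ≤ A ⊔ B) h
    · intro x y h; exact (le_sup_right : B ≤ A ⊔ B) h

theorem comap_map_square (s : Setoid U) {l : U → V} {k : T → V} {j : P → T} {m : P → U}
    (hl : l.Injective) (hk : k.Injective) (hj : j.Injective)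
    (comm : ∀ x, k (j x) = l (m x)) (pull : ∀ t u, k t = l u → ∃ x, j x = t ∧ m x = u) :
    (s.map l).comap k = (s.comap m).map j := by
  ext x y
  rw [Setoid.comap_rel, map_rel hl, map_rel hj]
  constructor
  · rintro (h | ⟨u, v, h, hu, hv⟩)
    · exact Or.inl (hk h)
    · obtain ⟨x', rfl, rfl⟩ := pull _ _ hu.symm
      obtain ⟨y', rfl, rfl⟩ := pull _ _ hv.symm
      exact Or.inr ⟨x', y', h, rfl, rfl⟩
  · rintro (rfl | ⟨u, v, h, rfl, rfl⟩)
    · exact Or.inl rfl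
    · exact Or.inr ⟨m u, m v, h, (comm u).symm, (comm v).symm⟩

theorem missing_sup (G : Setoid U) (B : Setoid V) {l : U → V} {k : T → V} {j : P → T} {m : P → U}
    (hl : l.Injective) (comm : ∀ x, k (j x) = l (m x))
    (pull : ∀ t u, k t = l u → ∃ x, j x = t ∧ m x = u)
    (hB : ∀ x y, B x y → x = y ∨ (x ∈ Set.range k ∧ y ∈ Set.range k))
    (cover : ∀ x, x ∈ Set.range k ∨ x ∈ Set.range l) :
    missing (G.map l ⊔ B) k = missing G m := by
  have key : ∀ u, (∀ x, ¬ G (m x) u) → ∀ y, (G.map l ⊔ B) (l u) y → ∃ v, G u v ∧ l v = y := by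
    intro u hu y hy
    let Q : V → Prop := fun y => ∃ v, G u v ∧ l v = y
    have hA : G.map l ≤ Setoid.ker Q := by
      rw [map_le_iff]
      intro a b hab
      refine propext ⟨?_, ?_⟩
      · rintro ⟨v, h, h'⟩
        obtain rfl := hl h'
        exact ⟨b, G.trans' h hab, rfl⟩
      · rintro ⟨v, h, h'⟩
        obtain rfl := hl h'
        exact ⟨a, G.trans' h (G.symm' hab), rfl⟩
    have hno : ∀ t, ¬ Q (k t) := by
      rintro t ⟨v, h, h'⟩
      obtain ⟨x, -, rfl⟩ := pull t v h'.symm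
      exact hu x (G.symm' h)
    have hB' : B ≤ Setoid.ker Q := by
      intro x y hxy
      rcases hB x y hxy with rfl | ⟨⟨s, rfl⟩, ⟨s', rfl⟩⟩
      · rfl
      · exact propext ⟨fun h => (hno s h).elim, fun h => (hno s' h).elim⟩
    have h : Q (l u) = Q y := (sup_le hA hB') hy
    have h0 : Q (l u) := ⟨u, G.refl' _, rfl⟩
    rw [h] at h0
    exact h0
  symm
  unfold missing
  refine Set.ncard_congr (fun c _ => Quotient.map (sa := G) (sb := G.map l ⊔ B) l
    (fun a b h => (le_sup_left : G.map l ≤ _) (Setoid.le_comap_map h)) c) ?_ ?_ ?_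
  · intro c
    induction c using Quotient.inductionOn with
    | h u =>
      intro hu t ht
      have hu' : ∀ x, ¬ G (m x) u := fun x h => hu x (Quotient.sound h)
      have ht' : (G.map l ⊔ B) (k t) (l u) := Quotient.exact ht
      obtain ⟨v, hv, hvt⟩ := key u hu' (k t) (Setoid.symm' _ ht')
      obtain ⟨x, -, rfl⟩ := pull t v hvt.symm
      exact hu' x (G.symm' hv)
  · intro c c'
    induction c using Quotient.inductionOn with
    | h u =>
      induction c' using Quotient.inductionOn with
      | h u' =>
        intro hu _ h
        have hu' : ∀ x, ¬ G (m x) u := fun x h => hu x (Quotient.sound h)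
        obtain ⟨v, hv, hvt⟩ := key u hu' (l u') (Quotient.exact h)
        obtain rfl := hl hvt
        exact Quotient.sound hv
  · intro c
    induction c using Quotient.inductionOn with
    | h x =>
      intro hx
      rcases cover x with ⟨t, rfl⟩ | ⟨u, rfl⟩
      · exact (hx t rfl).elim
      · refine ⟨Quotient.mk G u, ?_, rfl⟩
        intro y hy
        refine hx (j y) (Quotient.sound ?_)
        rw [comm]
        exact (le_sup_left : G.map l ≤ _) (Setoid.le_comap_map (Quotient.exact hy))

theorem missing_comp [Finite V] (E : Setoid V) (k : T → V) (s : P → T) :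
    missing E (k ∘ s) = missing E k + missing (E.comap k) s := by
  have hinj : Function.Injective (Quotient.map (sa := E.comap k) (sb := E) k (fun a b h => h)) := by
    intro c c'
    induction c using Quotient.inductionOn
    induction c' using Quotient.inductionOn
    intro h
    exact Quotient.sound (Quotient.exact h : E _ _)
  unfold missing
  rw [← Set.ncard_image_of_injective {c : Quotient (E.comap k) | ∀ t, Quotient.mk _ (s t) ≠ c} hinj,
    ← Set.ncard_union_eq]
  · congr 1
    ext c
    constructor
    · intro h
      by_cases hc : ∀ t, Quotient.mk E (k t) ≠ c
      · exact Or.inl hc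
      · push Not at hc
        obtain ⟨t, rfl⟩ := hc
        refine Or.inr ⟨Quotient.mk _ t, ?_, rfl⟩
        intro r hr
        exact h r (Quotient.sound (Quotient.exact hr : (E.comap k) _ _))
    · rintro (h | ⟨c', h, rfl⟩)
      · exact fun r => h (s r)
      · intro r hr
        exact h r (hinj hr)
  · rw [Set.disjoint_left]
    rintro _ h ⟨c', -, rfl⟩
    induction c' using Quotient.inductionOn with
    | h t => exact h t rfl

/-- The partition of four rows generated by three partitions of consecutive rows. -/
def glue₃ (d : Setoid (X ⊕ Y)) (e : Setoid (Y ⊕ Z)) (f : Setoid (Z ⊕ W)) :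
    Setoid (X ⊕ (Y ⊕ (Z ⊕ W))) :=
  d.map (Sum.map id Sum.inl) ⊔ e.map (Sum.inr ∘ Sum.map id Sum.inl) ⊔ f.map (Sum.inr ∘ Sum.inr)

variable (d : Setoid (X ⊕ Y)) (e : Setoid (Y ⊕ Z)) (f : Setoid (Z ⊕ W))

theorem glue₃_left : glue₃ d e f =
    (glue d e).map (Sum.map id (Sum.map id Sum.inl)) ⊔ f.map (Sum.inr ∘ Sum.inr) := by
  rw [glue, map_sup_eq, map_map_eq, map_map_eq, glue₃]
  congr 3
  ext x
  cases x <;> rfl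

theorem glue₃_right : glue₃ d e f =
    (glue e f).map Sum.inr ⊔ d.map (Sum.map id Sum.inl) := by
  rw [glue, map_sup_eq, map_map_eq, map_map_eq, glue₃, sup_assoc, sup_comm]

theorem range_of_map_rel {l : U → V} {k : T → V} (hl : l.Injective) (s : Setoid U)
    (h : ∀ u, l u ∈ Set.range k) (x y : V) (hxy : s.map l x y) :
    x = y ∨ (x ∈ Set.range k ∧ y ∈ Set.range k) := by
  rcases (map_rel hl s x y).1 hxy with rfl | ⟨u, v, -, rfl, rfl⟩
  · exact Or.inl rfl
  · exact Or.inr ⟨h u, h v⟩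

theorem injective_left : Function.Injective
    (Sum.map id (Sum.map id Sum.inl) : X ⊕ (Y ⊕ Z) → X ⊕ (Y ⊕ (Z ⊕ W))) :=
  Sum.map_injective.2 ⟨Function.injective_id, Sum.map_injective.2
    ⟨Function.injective_id, Sum.inl_injective⟩⟩

theorem injective_mapInl : Function.Injective (Sum.map id Sum.inl : X ⊕ Y → X ⊕ (Y ⊕ Z)) :=
  Sum.map_injective.2 ⟨Function.injective_id, Sum.inl_injective⟩

theorem injective_outer : Function.Injective (outer : X ⊕ Z → X ⊕ (Y ⊕ Z)) :=
  Sum.map_injective.2 ⟨Function.injective_id, Sum.inr_injective⟩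

theorem glue_concat_left :
    glue (concat d e) f = (glue₃ d e f).comap (Sum.map id Sum.inr) := by
  rw [glue₃_left, comap_sup_eq]
  · rw [glue, concat]
    congr 1
    · symm
      refine comap_map_square (glue d e) injective_left injective_outer injective_mapInl ?_ ?_
      · rintro (x | z) <;> rfl
      · rintro (x | z | w) (x' | y' | z') h <;> simp at h <;> subst h
        · exact ⟨Sum.inl x, rfl, rfl⟩
        · exact ⟨Sum.inr z, rfl, rfl⟩
    · symm
      refine comap_map_square (m := id) (j := Sum.inr) f (Sum.inr_injective.comp Sum.inr_injective)
        injective_outer Sum.inr_injective ?_ ?_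
      · rintro (z | w) <;> rfl
      · rintro (x | z | w) (z' | w') h <;> simp at h <;> subst h
        · exact ⟨Sum.inl z, rfl, rfl⟩
        · exact ⟨Sum.inr w, rfl, rfl⟩
  · refine range_of_map_rel (Sum.inr_injective.comp Sum.inr_injective) f ?_
    rintro (z | w)
    · exact ⟨Sum.inr (Sum.inl z), rfl⟩
    · exact ⟨Sum.inr (Sum.inr w), rfl⟩

theorem injective_right : Function.Injective
    (Sum.map id (Sum.map id Sum.inr) : X ⊕ (Y ⊕ W) → X ⊕ (Y ⊕ (Z ⊕ W))) :=
  Sum.map_injective.2 ⟨Function.injective_id, Sum.map_injective.2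
    ⟨Function.injective_id, Sum.inr_injective⟩⟩

theorem glue_concat_right :
    glue d (concat e f) = (glue₃ d e f).comap (Sum.map id (Sum.map id Sum.inr)) := by
  rw [glue₃_right, comap_sup_eq, sup_comm]
  · rw [glue, concat]
    congr 1
    · symm
      refine comap_map_square (m := id) (j := Sum.map id Sum.inl) d injective_mapInl
        injective_right injective_mapInl ?_ ?_
      · rintro (z | w) <;> rfl
      · rintro (x | y | w) (x' | y') h <;> simp at h <;> subst h
        · exact ⟨Sum.inl x, rfl, rfl⟩
        · exact ⟨Sum.inr y, rfl, rfl⟩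
    · symm
      refine comap_map_square (glue e f) Sum.inr_injective injective_right Sum.inr_injective ?_ ?_
      · rintro (x | z) <;> rfl
      · rintro (x | y | w) (y' | z' | w') h <;> simp at h <;> subst h
        · exact ⟨Sum.inl y, rfl, rfl⟩
        · exact ⟨Sum.inr w, rfl, rfl⟩
  · refine range_of_map_rel injective_mapInl d ?_
    rintro (x | y)
    · exact ⟨Sum.inl x, rfl⟩
    · exact ⟨Sum.inr (Sum.inl y), rfl⟩

theorem concat_assoc : concat (concat d e) f = concat d (concat e f) := by
  rw [concat, glue_concat_left, concat, glue_concat_right]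
  ext x y
  rcases x with x | x <;> rcases y with y | y <;> exact Iff.rfl

theorem missing_left :
    missing (glue₃ d e f) (Sum.map id Sum.inr : X ⊕ (Z ⊕ W) → X ⊕ (Y ⊕ (Z ⊕ W))) = loops d e := by
  rw [glue₃_left, loops]
  refine missing_sup (j := (Sum.map id Sum.inl : X ⊕ Z → X ⊕ (Z ⊕ W))) (glue d e) _ injective_left
    ?_ ?_ ?_ ?_
  · rintro (x | z) <;> rfl
  · rintro (x | z | w) (x' | y' | z') h <;> simp at h <;> subst h
    · exact ⟨Sum.inl x, rfl, rfl⟩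
    · exact ⟨Sum.inr z, rfl, rfl⟩
  · refine range_of_map_rel (Sum.inr_injective.comp Sum.inr_injective) f ?_
    rintro (z | w)
    · exact ⟨Sum.inr (Sum.inl z), rfl⟩
    · exact ⟨Sum.inr (Sum.inr w), rfl⟩
  · rintro (x | y | z | w)
    · exact Or.inl ⟨Sum.inl x, rfl⟩
    · exact Or.inr ⟨Sum.inr (Sum.inl y), rfl⟩
    · exact Or.inl ⟨Sum.inr (Sum.inl z), rfl⟩
    · exact Or.inl ⟨Sum.inr (Sum.inr w), rfl⟩

theorem missing_right :
    missing (glue₃ d e f) (Sum.map id (Sum.map id Sum.inr) : X ⊕ (Y ⊕ W) → X ⊕ (Y ⊕ (Z ⊕ W))) =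
      loops e f := by
  rw [glue₃_right, loops]
  refine missing_sup (j := (Sum.inr : Y ⊕ W → X ⊕ (Y ⊕ W))) (glue e f) _ Sum.inr_injective
    ?_ ?_ ?_ ?_
  · rintro (x | z) <;> rfl
  · rintro (x | y | w) (y' | z' | w') h <;> simp at h <;> subst h
    · exact ⟨Sum.inl y, rfl, rfl⟩
    · exact ⟨Sum.inr w, rfl, rfl⟩
  · refine range_of_map_rel injective_mapInl d ?_
    rintro (x | y)
    · exact ⟨Sum.inl x, rfl⟩
    · exact ⟨Sum.inr (Sum.inl y), rfl⟩
  · rintro (x | y)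
    · exact Or.inl ⟨Sum.inl x, rfl⟩
    · exact Or.inr ⟨y, rfl⟩

theorem loops_assoc [Finite X] [Finite Y] [Finite Z] [Finite W] :
    loops d e + loops (concat d e) f = loops e f + loops d (concat e f) := by
  have h1 := missing_comp (glue₃ d e f)
    (Sum.map id Sum.inr : X ⊕ (Z ⊕ W) → X ⊕ (Y ⊕ (Z ⊕ W))) (outer : X ⊕ W → X ⊕ (Z ⊕ W))
  have h2 := missing_comp (glue₃ d e f)
    (Sum.map id (Sum.map id Sum.inr) : X ⊕ (Y ⊕ W) → X ⊕ (Y ⊕ (Z ⊕ W)))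
    (outer : X ⊕ W → X ⊕ (Y ⊕ W))
  rw [missing_left, ← glue_concat_left] at h1
  rw [missing_right, ← glue_concat_right] at h2
  have h3 : (Sum.map id Sum.inr : X ⊕ (Z ⊕ W) → X ⊕ (Y ⊕ (Z ⊕ W))) ∘ outer =
      Sum.map id (Sum.map id Sum.inr) ∘ (outer : X ⊕ W → X ⊕ (Y ⊕ W)) := by
    ext x
    cases x <;> rfl
  rw [h3] at h1
  exact h1.symm.trans h2

end Concatenation

end Brauer

namespace Brauer

section Pairings

variable {V S X Y Z : Type*}

/-- Every part of the partition has exactly two elements. -/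
def IsPairing (d : Setoid S) : Prop := ∀ x, {y | d x y}.ncard = 2

theorem isPairing_iff (d : Setoid S) : IsPairing d ↔ ∀ x, ∃! y, y ≠ x ∧ d x y := by
  refine forall_congr' fun x => ⟨fun h => ?_, ?_⟩
  · obtain ⟨a, b, hab, h⟩ := Set.ncard_eq_two.1 h
    have hx : x ∈ ({a, b} : Set S) := h ▸ (d.refl' x : d x x)
    have hmem : ∀ y, d x y ↔ y = a ∨ y = b := fun y => by
      have : y ∈ {y | d x y} ↔ y ∈ ({a, b} : Set S) := by rw [h]
      simpa using this
    rcases hx with rfl | rfl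
    · exact ⟨b, ⟨hab.symm, (hmem b).2 (Or.inr rfl)⟩, fun y hy => ((hmem y).1 hy.2).resolve_left hy.1⟩
    · exact ⟨a, ⟨hab, (hmem a).2 (Or.inl rfl)⟩, fun y hy => ((hmem y).1 hy.2).resolve_right hy.1⟩
  · rintro ⟨y, ⟨hne, hy⟩, huniq⟩
    refine Set.ncard_eq_two.2 ⟨x, y, hne.symm, ?_⟩
    ext z
    simp only [Set.mem_ofPred_eq, Set.mem_insert_iff, Set.mem_singleton_iff]
    constructor
    · intro hz
      by_cases h : z = x
      · exact Or.inl h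
      · exact Or.inr (huniq z ⟨h, hz⟩)
    · rintro (rfl | rfl)
      · exact d.refl' _
      · exact hy

theorem int_aux {p k l : ℤ} (hk : ¬ p ∣ k) (hl : ¬ p ∣ l)
    (hk2 : p ∣ 2 * k ∨ p ∣ 2 * k + 1) (hl2 : p ∣ 2 * l ∨ p ∣ 2 * l + 1) : p ∣ k - l := by
  have two : ∀ m, p ∣ 2 * m → ¬ p ∣ m → ∃ c, p = 2 * c ∧ ∃ u, m = c * (2 * u + 1) := by
    rintro m ⟨a, ha⟩ hm
    rcases Int.even_or_odd' a with ⟨u, rfl | rfl⟩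
    · exact (hm ⟨u, by linarith⟩).elim
    · rcases Int.even_or_odd' p with ⟨c, rfl | rfl⟩
      · exact ⟨c, rfl, u, by linarith⟩
      · exfalso
        have : 2 * m = 2 * (2 * c * u + c + u) + 1 := by rw [ha]; ring
        omega
  have odd : ∀ m c, p = 2 * c → ¬ p ∣ 2 * m + 1 := by
    rintro m c rfl ⟨a, ha⟩
    have : 2 * m + 1 = 2 * (c * a) := by rw [ha]; ring
    omega
  rcases hk2 with hk2 | hk2 <;> rcases hl2 with hl2 | hl2
  · obtain ⟨c, hc, u, hu⟩ := two k hk2 hk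
    obtain ⟨c', hc', u', hu'⟩ := two l hl2 hl
    have : c = c' := by omega
    subst this
    exact ⟨u - u', by rw [hu, hu', hc]; ring⟩
  · obtain ⟨c, hc, -⟩ := two k hk2 hk
    exact (odd l c hc hl2).elim
  · obtain ⟨c, hc, -⟩ := two l hl2 hl
    exact (odd k c hc hk2).elim
  · have h : p ∣ 2 * (k - l) := by
      have := dvd_sub hk2 hl2
      ring_nf at this ⊢
      exact this
    by_contra hne
    obtain ⟨c, hc, -⟩ := two _ h hne
    exact odd k c hc hk2

theorem exists_unique_end [Finite V] {f g : V → V} (hf : Function.Involutive f)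
    (hg : Function.Involutive g) (E : Setoid V) (hEf : ∀ x, E x (f x)) (hEg : ∀ x, E x (g x))
    (hE : ∀ S : Setoid V, (∀ x, S x (f x)) → (∀ x, S x (g x)) → E ≤ S)
    {v : V} (hv : f v = v) (hv' : g v ≠ v) :
    ∃! w, w ≠ v ∧ (f w = w ∨ g w = w) ∧ E v w := by
  classical
  let F : Equiv.Perm V := hf.toPerm
  let G : Equiv.Perm V := hg.toPerm
  let π : Equiv.Perm V := F * G
  have hFF : F * F = 1 := Equiv.ext hf
  have hGG : G * G = 1 := Equiv.ext hg
  have hFi : F⁻¹ = F := inv_eq_of_mul_eq_one_left hFF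
  have hGi : G⁻¹ = G := inv_eq_of_mul_eq_one_left hGG
  have hπi : F * π * F⁻¹ = π⁻¹ := by
    simp only [π, mul_inv_rev, hFi, hGi]
    rw [← mul_assoc, hFF, one_mul]
  have hFk : ∀ k : ℤ, f ((π ^ k) v) = (π ^ (-k)) v := by
    intro k
    have h := conj_zpow (a := F) (b := π) (i := k)
    rw [hπi, inv_zpow', hFi] at h
    rw [h]
    change _ = F ((π ^ k) (f v))
    rw [hv]
    rfl
  have hFg : ∀ x, f (π x) = g x := fun x => hf (g x)
  have hGk : ∀ k : ℤ, g ((π ^ k) v) = (π ^ (-(k + 1))) v := by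
    intro k
    rw [← hFk, ← hFg, add_comm, zpow_add, zpow_one]
    rfl
  have hEπ : ∀ x, E x (π x) := fun x => E.trans' (hEg x) (hEf (g x))
  have horb : ∀ w, E v w ↔ ∃ k : ℤ, (π ^ k) v = w := by
    intro w
    constructor
    · let Q : V → Prop := fun w => ∃ k : ℤ, (π ^ k) v = w
      have h1 : ∀ x, Q x → Q (f x) := by
        rintro _ ⟨k, rfl⟩; exact ⟨-k, (hFk k).symm⟩
      have h2 : ∀ x, Q x → Q (g x) := by
        rintro _ ⟨k, rfl⟩; exact ⟨_, (hGk k).symm⟩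
      have h := hE (Setoid.ker Q)
        (fun x => propext ⟨h1 x, fun h => by simpa only [hf x] using h1 _ h⟩)
        (fun x => propext ⟨h2 x, fun h => by simpa only [hg x] using h2 _ h⟩)
      intro hw
      have h3 : Q v = Q w := h hw
      have h4 : Q v := ⟨0, rfl⟩
      rw [h3] at h4
      exact h4
    · rintro ⟨k, rfl⟩
      induction k using Int.induction_on with
      | zero => exact E.refl' _
      | succ i ih =>
        rw [add_comm, zpow_add, zpow_one]
        exact E.trans' ih (hEπ _)
      | pred i ih =>
        refine E.trans' ih (E.symm' ?_)
        have := hEπ ((π ^ (-(i : ℤ) - 1)) v)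
        rw [← Equiv.Perm.mul_apply, ← zpow_one_add] at this
        convert this using 3
        ring
  let p : ℕ := MulAction.period π v
  have hdvd : ∀ k : ℤ, (π ^ k) v = v ↔ (p : ℤ) ∣ k := fun k =>
    MulAction.zpow_smul_eq_iff_period_dvd (g := π) (a := v) (j := k)
  have heq : ∀ k l : ℤ, (π ^ k) v = (π ^ l) v ↔ (p : ℤ) ∣ k - l := by
    intro k l
    rw [← hdvd, sub_eq_neg_add, zpow_add, zpow_neg, Equiv.Perm.mul_apply, Equiv.Perm.inv_eq_iff_eq]
  have hfix : ∀ k : ℤ, (f ((π ^ k) v) = (π ^ k) v ∨ g ((π ^ k) v) = (π ^ k) v) ↔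
      ((p : ℤ) ∣ 2 * k ∨ (p : ℤ) ∣ 2 * k + 1) := by
    intro k
    rw [hFk, hGk, heq, heq, ← dvd_neg, ← dvd_neg (b := -(k + 1) - k)]
    ring_nf
  have hp : 0 < p := MulAction.period_pos_of_orderOf_pos (orderOf_pos π) v
  have hp1 : p ≠ 1 := by
    intro h1
    have h : g ((π ^ (0 : ℤ)) v) = (π ^ (0 : ℤ)) v := by
      rw [hGk, heq, h1]; simp
    exact hv' h
  refine existsUnique_of_exists_of_unique ?_ ?_
  · rcases Nat.even_or_odd' p with ⟨c, hc | hc⟩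
    · refine ⟨(π ^ (c : ℤ)) v, ?_, (hfix _).2 (Or.inl ?_), (horb _).2 ⟨_, rfl⟩⟩
      · rw [Ne, hdvd]
        intro h
        have := Int.le_of_dvd (by omega) h
        omega
      · exact ⟨1, by omega⟩
    · refine ⟨(π ^ (c : ℤ)) v, ?_, (hfix _).2 (Or.inr ?_), (horb _).2 ⟨_, rfl⟩⟩
      · rw [Ne, hdvd]
        intro h
        have := Int.le_of_dvd (by omega) h
        omega
      · exact ⟨1, by omega⟩
  · rintro _ _ ⟨h1, h2, h3⟩ ⟨h1', h2', h3'⟩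
    obtain ⟨k, rfl⟩ := (horb _).1 h3
    obtain ⟨l, rfl⟩ := (horb _).1 h3'
    rw [heq]
    rw [Ne, hdvd] at h1 h1'
    exact int_aux h1 h1' ((hfix k).1 h2) ((hfix l).1 h2')

/-- The involution attached to a partition into pairs. -/
theorem exists_partner {d : Setoid S} (hd : IsPairing d) :
    ∃ f : S → S, Function.Involutive f ∧ (∀ x, f x ≠ x) ∧ ∀ x y, d x y ↔ y = x ∨ y = f x := by
  choose f hf hu using (isPairing_iff d).1 hd
  simp only at hf hu
  refine ⟨f, fun x => ?_, fun x => (hf x).1, fun x y => ⟨fun h => ?_, ?_⟩⟩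
  · exact (hu (f x) x ⟨(hf x).1.symm, d.symm' (hf x).2⟩).symm
  · by_cases hy : y = x
    · exact Or.inl hy
    · exact Or.inr (hu x y ⟨hy, h⟩)
  · rintro (rfl | rfl)
    · exact d.refl' _
    · exact (hf x).2

theorem isPairing_concat [Finite X] [Finite Y] [Finite Z] {d : Setoid (X ⊕ Y)} {e : Setoid (Y ⊕ Z)}
    (hd : IsPairing d) (he : IsPairing e) : IsPairing (concat d e) := by
  obtain ⟨f, hf, hf', hdf⟩ := exists_partner hd
  obtain ⟨g, hg, hg', heg⟩ := exists_partner he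
  let i : X ⊕ Y → X ⊕ (Y ⊕ Z) := Sum.map id Sum.inl
  let F : X ⊕ (Y ⊕ Z) → X ⊕ (Y ⊕ Z) := fun v => match v with
    | Sum.inl x => i (f (Sum.inl x))
    | Sum.inr (Sum.inl y) => i (f (Sum.inr y))
    | Sum.inr (Sum.inr z) => Sum.inr (Sum.inr z)
  let G : X ⊕ (Y ⊕ Z) → X ⊕ (Y ⊕ Z) := fun v => match v with
    | Sum.inl x => Sum.inl x
    | Sum.inr u => Sum.inr (g u)
  have hFi : ∀ u, F (i u) = i (f u) := by rintro (x | y) <;> rfl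
  have hi : i.Injective := injective_mapInl
  have hcov : ∀ v, (∃ u, i u = v) ∨ ∃ z, v = Sum.inr (Sum.inr z) := by
    rintro (x | y | z)
    · exact Or.inl ⟨Sum.inl x, rfl⟩
    · exact Or.inl ⟨Sum.inr y, rfl⟩
    · exact Or.inr ⟨z, rfl⟩
  have hF : Function.Involutive F := by
    intro v
    rcases hcov v with ⟨u, rfl⟩ | ⟨z, rfl⟩
    · rw [hFi, hFi, hf]
    · rfl
  have hG : Function.Involutive G := by
    rintro (x | u)
    · rfl
    · exact congrArg Sum.inr (hg u)
  have hEF : ∀ v, glue d e v (F v) := by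
    intro v
    rcases hcov v with ⟨u, rfl⟩ | ⟨z, rfl⟩
    · rw [hFi]
      exact (le_sup_left : _ ≤ glue d e) (Setoid.le_comap_map ((hdf _ _).2 (Or.inr rfl)))
    · exact Setoid.refl' _ _
  have hEG : ∀ v, glue d e v (G v) := by
    rintro (x | u)
    · exact Setoid.refl' _ _
    · exact (le_sup_right : _ ≤ glue d e) (Setoid.le_comap_map ((heg _ _).2 (Or.inr rfl)))
  have hE : ∀ S : Setoid (X ⊕ (Y ⊕ Z)), (∀ x, S x (F x)) → (∀ x, S x (G x)) → glue d e ≤ S := by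
    intro S h1 h2
    refine sup_le ((map_le_iff _ _ _).2 ?_) ((map_le_iff _ _ _).2 ?_)
    · intro u v huv
      rcases (hdf u v).1 huv with rfl | rfl
      · exact Setoid.refl' _ _
      · have := h1 (i u)
        rw [hFi] at this
        exact this
    · intro u v huv
      rcases (heg u v).1 huv with rfl | rfl
      · exact Setoid.refl' _ _
      · exact h2 (Sum.inr u)
  have hends : ∀ v, (F v = v ∨ G v = v) ↔ ∃ b, outer b = v := by
    rintro (x | y | z)
    · exact ⟨fun _ => ⟨Sum.inl x, rfl⟩, fun _ => Or.inr rfl⟩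
    · constructor
      · rintro (h | h)
        · exact (hf' _ (hi h)).elim
        · exact (hg' _ (Sum.inr_injective h)).elim
      · rintro ⟨x | z, h⟩ <;> simp [outer] at h
    · exact ⟨fun _ => ⟨Sum.inr z, rfl⟩, fun _ => Or.inl rfl⟩
  have main : ∀ b : X ⊕ Z, ∃! w, w ≠ (outer b : X ⊕ (Y ⊕ Z)) ∧ (F w = w ∨ G w = w) ∧
      glue d e (outer b) w := by
    rintro (x | z)
    · have := exists_unique_end hG hF (glue d e) hEG hEF (fun S h1 h2 => hE S h2 h1)
        (v := outer (Sum.inl x)) rfl (fun h => hf' _ (hi h))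
      simpa only [or_comm] using this
    · exact exists_unique_end hF hG (glue d e) hEF hEG hE
        (v := outer (Sum.inr z)) rfl (fun h => hg' _ (Sum.inr_injective h))
  rw [isPairing_iff]
  intro b
  obtain ⟨w, ⟨h1, h2, h3⟩, hu⟩ := main b
  obtain ⟨c, rfl⟩ := (hends w).1 h2
  refine ⟨c, ⟨fun h => h1 (h ▸ rfl), h3⟩, ?_⟩
  rintro c' ⟨h1', h3'⟩
  exact injective_outer (hu _ ⟨fun h => h1' (injective_outer h), (hends _).2 ⟨_, rfl⟩, h3'⟩)

/-- The partition of two equal rows into the pairs formed by an element and its copy. -/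
def idPairing (X : Type*) : Setoid (X ⊕ X) := Setoid.ker (Sum.elim id id)

theorem isPairing_id : IsPairing (idPairing X) := by
  rw [isPairing_iff]
  rintro (x | x)
  · refine ⟨Sum.inr x, ⟨by simp, rfl⟩, ?_⟩
    rintro (y | y) ⟨h, h'⟩
    · exact (h (congrArg Sum.inl (h' : x = y).symm)).elim
    · exact congrArg Sum.inr (h' : x = y).symm
  · refine ⟨Sum.inl x, ⟨by simp, rfl⟩, ?_⟩
    rintro (y | y) ⟨h, h'⟩
    · exact congrArg Sum.inl (h' : x = y).symm
    · exact (h (congrArg Sum.inr (h' : x = y).symm)).elim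

theorem glue_id_left (e : Setoid (X ⊕ Z)) :
    glue (idPairing X) e = e.comap (Sum.elim Sum.inl id) := by
  apply le_antisymm
  · refine sup_le ((map_le_iff _ _ _).2 ?_) ((map_le_iff _ _ _).2 ?_)
    · rintro (x | x) (y | y) h <;> obtain rfl : x = y := h <;> exact Setoid.refl' _ _
    · intro u v h; exact h
  · have hl : ∀ v, glue (idPairing X) e v (Sum.inr (Sum.elim Sum.inl id v)) := by
      rintro (x | u)
      · exact (le_sup_left : _ ≤ glue (idPairing X) e)
          (Setoid.le_comap_map (show idPairing X (Sum.inl x) (Sum.inr x) from rfl))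
      · exact Setoid.refl' _ _
    intro v w h
    refine Setoid.trans' _ (hl v) (Setoid.trans' _ ?_ (Setoid.symm' _ (hl w)))
    exact (le_sup_right : _ ≤ glue (idPairing X) e) (Setoid.le_comap_map h)

theorem glue_id_right (d : Setoid (X ⊕ Y)) :
    glue d (idPairing Y) = d.comap (Sum.elim Sum.inl (Sum.elim Sum.inr Sum.inr)) := by
  apply le_antisymm
  · refine sup_le ((map_le_iff _ _ _).2 ?_) ((map_le_iff _ _ _).2 ?_)
    · rintro (x | x) (y | y) h <;> exact h
    · rintro (x | x) (y | y) h <;> obtain rfl : x = y := h <;> exact Setoid.refl' _ _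
  · have hl : ∀ v, glue d (idPairing Y) v
        (Sum.map id Sum.inl (Sum.elim Sum.inl (Sum.elim Sum.inr Sum.inr) v : X ⊕ Y)) := by
      rintro (x | y | y)
      · exact Setoid.refl' _ _
      · exact Setoid.refl' _ _
      · exact (le_sup_right : _ ≤ glue d (idPairing Y))
          (Setoid.le_comap_map (show idPairing Y (Sum.inr y) (Sum.inl y) from rfl))
    intro v w h
    refine Setoid.trans' _ (hl v) (Setoid.trans' _ ?_ (Setoid.symm' _ (hl w)))
    exact (le_sup_left : _ ≤ glue d (idPairing Y)) (Setoid.le_comap_map h)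

theorem concat_id_left (e : Setoid (X ⊕ Z)) : concat (idPairing X) e = e := by
  rw [concat, glue_id_left]
  ext x y
  rcases x with x | x <;> rcases y with y | y <;> exact Iff.rfl

theorem concat_id_right (d : Setoid (X ⊕ Y)) : concat d (idPairing Y) = d := by
  rw [concat, glue_id_right]
  ext x y
  rcases x with x | x <;> rcases y with y | y <;> exact Iff.rfl

theorem loops_eq_zero (d : Setoid (X ⊕ Y)) (e : Setoid (Y ⊕ Z))
    (h : ∀ y, ∃ b, glue d e (outer b) (Sum.inr (Sum.inl y))) : loops d e = 0 := by
  have h0 : {c | ∀ b, Quotient.mk (glue d e) (outer b) ≠ c} = ∅ := ?_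
  · rw [loops, missing, h0, Set.ncard_empty]
  refine Set.eq_empty_iff_forall_notMem.2 fun c hc => ?_
  suffices ∃ b, Quotient.mk (glue d e) (outer b) = c from this.elim fun b hb => hc b hb
  clear hc
  induction c using Quotient.inductionOn with
  | h v =>
    rcases v with x | y | z
    · exact ⟨Sum.inl x, rfl⟩
    · obtain ⟨b, hb⟩ := h y
      exact ⟨b, Quotient.sound hb⟩
    · exact ⟨Sum.inr z, rfl⟩

theorem loops_id_left (e : Setoid (X ⊕ Z)) : loops (idPairing X) e = 0 := by
  refine loops_eq_zero _ _ fun x => ⟨Sum.inl x, ?_⟩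
  rw [glue_id_left]
  exact Setoid.refl' _ _

theorem loops_id_right (d : Setoid (X ⊕ Y)) : loops d (idPairing Y) = 0 := by
  refine loops_eq_zero _ _ fun x => ⟨Sum.inr x, ?_⟩
  rw [glue_id_right]
  exact Setoid.refl' _ _

end Pairings

end Brauer

namespace Brauer

universe u

section Algebra

/-- Brauer diagrams: partitions of `{1, …, n} ∪ {1', …, n'}` into parts with two elements.
The left row is `Sum.inl`, the right (primed) row is `Sum.inr`. -/
def Diagram (n : ℕ) : Type := {d : Setoid (Fin n ⊕ Fin n) // IsPairing d}

namespace Diagram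

variable {n : ℕ}

/-- Concatenation, `d` on the left and `e` on the right, with the loops removed. -/
def mul (d e : Diagram n) : Diagram n := ⟨concat d.1 e.1, isPairing_concat d.2 e.2⟩

/-- The number of loops that appear in the concatenation. -/
noncomputable def loops (d e : Diagram n) : ℕ := Brauer.loops d.1 e.1

/-- The diagram that joins every `i` to `i'`. -/
def one (n : ℕ) : Diagram n := ⟨idPairing (Fin n), isPairing_id⟩

theorem mul_assoc' (d e f : Diagram n) : mul (mul d e) f = mul d (mul e f) :=
  Subtype.ext (concat_assoc _ _ _)

theorem one_mul' (d : Diagram n) : mul (one n) d = d := Subtype.ext (concat_id_left _)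

theorem mul_one' (d : Diagram n) : mul d (one n) = d := Subtype.ext (concat_id_right _)

/-- The number of left-to-right connections. -/
noncomputable def through (d : Diagram n) : ℕ := {i | ∃ j, d.1 (Sum.inl i) (Sum.inr j)}.ncard

theorem eq_of_rel (d : Diagram n) {x y z : Fin n ⊕ Fin n} (hy : d.1 x y) (hz : d.1 x z)
    (hyx : y ≠ x) (hzx : z ≠ x) : y = z :=
  ((isPairing_iff d.1).1 d.2 x).unique ⟨hyx, hy⟩ ⟨hzx, hz⟩

theorem exists_rel (d : Diagram n) (x : Fin n ⊕ Fin n) : ∃ y, y ≠ x ∧ d.1 x y :=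
  ((isPairing_iff d.1).1 d.2 x).exists

theorem through_eq_right (d : Diagram n) :
    through d = {j | ∃ i, d.1 (Sum.inl i) (Sum.inr j)}.ncard := by
  refine Set.ncard_congr (fun i hi => hi.choose) (fun i hi => ⟨i, hi.choose_spec⟩) ?_ ?_
  · intro i i' hi hi' h
    have h1 := hi.choose_spec
    have h2 := hi'.choose_spec
    rw [← h] at h2
    exact Sum.inl_injective
      (d.eq_of_rel (d.1.symm' h1) (d.1.symm' h2) Sum.inl_ne_inr Sum.inl_ne_inr)
  · rintro j ⟨i, hi⟩
    refine ⟨i, ⟨j, hi⟩, ?_⟩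
    exact Sum.inr_injective (d.eq_of_rel (Exists.choose_spec (⟨j, hi⟩ :
      ∃ j, d.1 (Sum.inl i) (Sum.inr j))) hi Sum.inr_ne_inl Sum.inr_ne_inl)

theorem through_le (d : Diagram n) : through d ≤ n :=
  (Set.ncard_le_card _).trans (by simp)

theorem mul_inl_inl (d e : Diagram n) {i j : Fin n} (h : d.1 (Sum.inl i) (Sum.inl j)) :
    (mul d e).1 (Sum.inl i) (Sum.inl j) :=
  (le_sup_left : _ ≤ glue d.1 e.1) (Setoid.le_comap_map h)

theorem mul_inr_inr (d e : Diagram n) {i j : Fin n} (h : e.1 (Sum.inr i) (Sum.inr j)) :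
    (mul d e).1 (Sum.inr i) (Sum.inr j) :=
  (le_sup_right : _ ≤ glue d.1 e.1) (Setoid.le_comap_map h)

theorem through_mul_le_left (d e : Diagram n) : through (mul d e) ≤ through d := by
  refine Set.ncard_le_ncard ?_
  rintro i ⟨j, hij⟩
  obtain ⟨y | y, hne, hy⟩ := d.exists_rel (Sum.inl i)
  · have := (mul d e).eq_of_rel (mul_inl_inl d e hy) hij hne Sum.inr_ne_inl
    exact (Sum.inl_ne_inr this).elim
  · exact ⟨y, hy⟩

theorem through_mul_le_right (d e : Diagram n) : through (mul d e) ≤ through e := by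
  rw [through_eq_right, through_eq_right]
  refine Set.ncard_le_ncard ?_
  rintro j ⟨i, hij⟩
  obtain ⟨y | y, hne, hy⟩ := e.exists_rel (Sum.inr j)
  · exact ⟨y, e.1.symm' hy⟩
  · have := (mul d e).eq_of_rel (mul_inr_inr d e hy) ((mul d e).1.symm' hij) hne Sum.inl_ne_inr
    exact (Sum.inr_ne_inl this).elim

theorem through_eq_iff (d : Diagram n) :
    through d = n ↔ ∀ i, ∃ j, d.1 (Sum.inl i) (Sum.inr j) := by
  rw [through]
  constructor
  · intro h i
    have : {i | ∃ j, d.1 (Sum.inl i) (Sum.inr j)} = Set.univ :=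
      Set.eq_of_subset_of_ncard_le (Set.subset_univ _) (by simp [h, Set.ncard_univ])
    exact this.ge (Set.mem_univ i)
  · intro h
    rw [Set.eq_univ_of_forall (s := {i | ∃ j, d.1 (Sum.inl i) (Sum.inr j)}) h]
    simp [Set.ncard_univ]

theorem through_eq_iff' (d : Diagram n) :
    through d = n ↔ ∀ j, ∃ i, d.1 (Sum.inl i) (Sum.inr j) := by
  rw [through_eq_right]
  constructor
  · intro h i
    have : {j | ∃ i, d.1 (Sum.inl i) (Sum.inr j)} = Set.univ :=
      Set.eq_of_subset_of_ncard_le (Set.subset_univ _) (by simp [h, Set.ncard_univ])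
    exact this.ge (Set.mem_univ i)
  · intro h
    rw [Set.eq_univ_of_forall (s := {j | ∃ i, d.1 (Sum.inl i) (Sum.inr j)}) h]
    simp [Set.ncard_univ]

theorem through_one : through (one n) = n :=
  (through_eq_iff _).2 fun i => ⟨i, rfl⟩

theorem through_mul_of_eq {d e : Diagram n} (hd : through d = n) (he : through e = n) :
    through (mul d e) = n := by
  rw [through_eq_iff] at *
  intro i
  obtain ⟨j, hj⟩ := hd i
  obtain ⟨k, hk⟩ := he j
  have h1 : glue d.1 e.1 (Sum.inl i) (Sum.inr (Sum.inl j)) :=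
    (le_sup_left : _ ≤ glue d.1 e.1) (Setoid.le_comap_map hj)
  have h2 : glue d.1 e.1 (Sum.inr (Sum.inl j)) (Sum.inr (Sum.inr k)) :=
    (le_sup_right : _ ≤ glue d.1 e.1) (Setoid.le_comap_map hk)
  exact ⟨k, Setoid.trans' (glue d.1 e.1) h1 h2⟩

theorem loops_eq_zero_of_through {d : Diagram n} (hd : through d = n) (e : Diagram n) :
    loops d e = 0 := by
  refine Brauer.loops_eq_zero _ _ fun y => ?_
  obtain ⟨i, hi⟩ := (through_eq_iff' d).1 hd y
  exact ⟨Sum.inl i, (le_sup_left : _ ≤ glue d.1 e.1) (Setoid.le_comap_map hi)⟩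

end Diagram

/-- The underlying module of the Brauer algebra `Br_n(δ)`: the free module on the diagrams. -/
def BrauerAlgebra (R : Type u) [CommRing R] (n : ℕ) (_δ : R) : Type u := Diagram n →₀ R

variable {R : Type u} [CommRing R] {n : ℕ} {δ : R}

noncomputable instance : AddCommGroup (BrauerAlgebra R n δ) :=
  inferInstanceAs (AddCommGroup (Diagram n →₀ R))

noncomputable instance : Module R (BrauerAlgebra R n δ) :=
  inferInstanceAs (Module R (Diagram n →₀ R))

namespace BrauerAlgebra

/-- The basis of diagrams. -/
noncomputable def basis (R : Type u) [CommRing R] (n : ℕ) (δ : R) :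
    Module.Basis (Diagram n) R (BrauerAlgebra R n δ) :=
  Module.Basis.ofRepr (LinearEquiv.refl R (Diagram n →₀ R))

/-- A diagram as an element of the Brauer algebra. -/
noncomputable def of (R : Type u) [CommRing R] {n : ℕ} (δ : R) (d : Diagram n) :
    BrauerAlgebra R n δ := basis R n δ d

/-- Concatenation of diagrams, every loop giving a factor `δ`, extended bilinearly. -/
noncomputable def mulMap (R : Type u) [CommRing R] (n : ℕ) (δ : R) :
    BrauerAlgebra R n δ →ₗ[R] BrauerAlgebra R n δ →ₗ[R] BrauerAlgebra R n δ :=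
  (basis R n δ).constr R fun d => (basis R n δ).constr R fun e =>
    δ ^ d.loops e • of R δ (d.mul e)

noncomputable instance : Mul (BrauerAlgebra R n δ) := ⟨fun x y => mulMap R n δ x y⟩

noncomputable instance : One (BrauerAlgebra R n δ) := ⟨of R δ (Diagram.one n)⟩

theorem mul_def (x y : BrauerAlgebra R n δ) : x * y = mulMap R n δ x y := rfl

theorem one_def : (1 : BrauerAlgebra R n δ) = of R δ (Diagram.one n) := rfl

theorem mulMap_of (d e : Diagram n) :
    mulMap R n δ (of R δ d) (of R δ e) = δ ^ d.loops e • of R δ (d.mul e) := by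
  simp only [mulMap, of, Module.Basis.constr_basis]

theorem of_mul_of (d e : Diagram n) :
    of R δ d * of R δ e = δ ^ d.loops e • of R δ (d.mul e) := mulMap_of d e

theorem induction {P : BrauerAlgebra R n δ → Prop} (hof : ∀ d, P (of R δ d))
    (hadd : ∀ x y, P x → P y → P (x + y)) (hsmul : ∀ (r : R) x, P x → P (r • x))
    (x : BrauerAlgebra R n δ) : P x := by
  have hx := (basis R n δ).mem_span x
  induction hx using Submodule.span_induction with
  | mem x h => obtain ⟨d, rfl⟩ := h; exact hof d
  | zero => simpa using hsmul 0 _ (hof (Diagram.one n))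
  | add x y _ _ hx hy => exact hadd x y hx hy
  | smul r x _ hx => exact hsmul r x hx

theorem mulMap_assoc (x y z : BrauerAlgebra R n δ) :
    mulMap R n δ (mulMap R n δ x y) z = mulMap R n δ x (mulMap R n δ y z) := by
  induction x using induction with
  | hadd x x' hx hx' => simp only [map_add, LinearMap.add_apply, hx, hx']
  | hsmul r x hx => simp only [map_smul, LinearMap.smul_apply, hx]
  | hof d =>
    induction y using induction with
    | hadd x x' hx hx' => simp only [map_add, LinearMap.add_apply, hx, hx']
    | hsmul r x hx => simp only [map_smul, LinearMap.smul_apply, hx]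
    | hof e =>
      induction z using induction with
      | hadd x x' hx hx' => simp only [map_add, hx, hx']
      | hsmul r x hx => simp only [map_smul, hx]
      | hof f =>
        simp only [mulMap_of, map_smul, LinearMap.smul_apply, smul_smul, ← pow_add]
        rw [Diagram.mul_assoc']
        congr 2
        have h := loops_assoc d.1 e.1 f.1
        simp only [Diagram.loops, Diagram.mul]
        omega

theorem one_mulMap (x : BrauerAlgebra R n δ) : mulMap R n δ (of R δ (Diagram.one n)) x = x := by
  induction x using induction with
  | hadd x x' hx hx' => simp only [map_add, hx, hx']
  | hsmul r x hx => simp only [map_smul, hx]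
  | hof d =>
    have h : (Diagram.one n).loops d = 0 := loops_id_left d.1
    rw [mulMap_of, Diagram.one_mul', h, pow_zero, one_smul]

theorem mulMap_one (x : BrauerAlgebra R n δ) : mulMap R n δ x (of R δ (Diagram.one n)) = x := by
  induction x using induction with
  | hadd x x' hx hx' => simp only [map_add, LinearMap.add_apply, hx, hx']
  | hsmul r x hx => simp only [map_smul, LinearMap.smul_apply, hx]
  | hof d =>
    have h : d.loops (Diagram.one n) = 0 := loops_id_right d.1
    rw [mulMap_of, Diagram.mul_one', h, pow_zero, one_smul]

noncomputable instance : Ring (BrauerAlgebra R n δ) :=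
  { (inferInstance : AddCommGroup (BrauerAlgebra R n δ)) with
    mul := (· * ·)
    one := 1
    mul_assoc := mulMap_assoc
    one_mul := one_mulMap
    mul_one := mulMap_one
    left_distrib := fun x y z => map_add (mulMap R n δ x) y z
    right_distrib := fun x y z => LinearMap.map_add₂ (mulMap R n δ) x y z
    zero_mul := fun x => LinearMap.map_zero₂ (mulMap R n δ) x
    mul_zero := fun x => map_zero (mulMap R n δ x) }

noncomputable instance : Algebra R (BrauerAlgebra R n δ) :=
  Algebra.ofModule (fun r x y => LinearMap.map_smul₂ (mulMap R n δ) r x y)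
    (fun r x y => map_smul (mulMap R n δ x) r y)

/-- The linear map that is `1` on diagrams with `n` left-to-right connections and `0` on
all others. -/
noncomputable def augmentationMap (R : Type u) [CommRing R] (n : ℕ) (δ : R) :
    BrauerAlgebra R n δ →ₗ[R] R :=
  open Classical in (basis R n δ).constr R fun d => if d.through = n then 1 else 0

open Classical in
theorem augmentationMap_of (d : Diagram n) :
    augmentationMap R n δ (of R δ d) = if d.through = n then 1 else 0 := by
  simp only [augmentationMap, of, Module.Basis.constr_basis]

/-- The augmentation of the Brauer algebra: diagrams with the maximal number `n` of
left-to-right connections go to `1`, all other diagrams go to `0`. -/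
noncomputable def augmentation (R : Type u) [CommRing R] (n : ℕ) (δ : R) :
    BrauerAlgebra R n δ →ₐ[R] R :=
  AlgHom.ofLinearMap (augmentationMap R n δ)
    (by rw [one_def, augmentationMap_of, if_pos Diagram.through_one])
    (by
      intro x y
      rw [mul_def]
      induction x using induction with
      | hadd x x' hx hx' => simp only [map_add, LinearMap.add_apply, hx, hx', add_mul]
      | hsmul r x hx => simp only [map_smul, LinearMap.smul_apply, hx, smul_mul_assoc]
      | hof d =>
        induction y using induction with
        | hadd x x' hx hx' => simp only [map_add, hx, hx', mul_add]
        | hsmul r x hx => simp only [map_smul, hx, mul_smul_comm]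
        | hof e =>
          rw [mulMap_of, map_smul, augmentationMap_of, augmentationMap_of, augmentationMap_of]
          by_cases hd : d.through = n
          · by_cases he : e.through = n
            · rw [if_pos hd, if_pos he, if_pos (Diagram.through_mul_of_eq hd he),
                Diagram.loops_eq_zero_of_through hd]
              simp
            · have := Diagram.through_mul_le_right d e
              have := Diagram.through_le e
              rw [if_neg he, if_neg (by omega)]
              simp
          · have := Diagram.through_mul_le_left d e
            have := Diagram.through_le d
            rw [if_neg hd, if_neg (by omega)]
            simp)

open Classical in
theorem augmentation_of (d : Diagram n) :
    augmentation R n δ (of R δ d) = if d.through = n then 1 else 0 := augmentationMap_of d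

end BrauerAlgebra

end Algebra

section LinkStates

/-- The defects of a partition: the elements that form a part on their own. -/
noncomputable def defects {n : ℕ} (p : Setoid (Fin n)) : Finset (Fin n) :=
  open Classical in Finset.univ.filter fun x => {y | p x y}.ncard = 1

/-- Brauer link states on `{1, …, n}` with `t` defects: partitions into parts of
cardinality `1` or `2`, exactly `t` of them of cardinality `1`. -/
structure LinkState (n t : ℕ) where
  /-- the partition -/
  rel : Setoid (Fin n)
  card_part : ∀ x, {y | rel x y}.ncard = 1 ∨ {y | rel x y}.ncard = 2
  card_defects : (defects rel).card = t

namespace LinkState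

variable {n t : ℕ}

/-- The `i`-th defect, in the order of `{1, …, n}`. -/
noncomputable def defect (p : LinkState n t) : Fin t ↪o Fin n :=
  (defects p.rel).orderEmbOfFin p.card_defects

theorem mem_defects_iff (p : Setoid (Fin n)) (x : Fin n) :
    x ∈ defects p ↔ ∀ y, p x y → y = x := by
  simp only [defects, Finset.mem_filter, Finset.mem_univ, true_and]
  rw [Set.ncard_eq_one]
  constructor
  · rintro ⟨a, ha⟩ y hy
    have h1 : x ∈ ({a} : Set (Fin n)) := ha.le (p.refl' x : p x x)
    have h2 : y ∈ ({a} : Set (Fin n)) := ha.le hy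
    rw [Set.mem_singleton_iff] at h1 h2
    rw [h1, h2]
  · intro h
    refine ⟨x, Set.eq_singleton_iff_unique_mem.2 ⟨p.refl' x, h⟩⟩

theorem eq_of_rel_defect (p : LinkState n t) {i : Fin t} {y : Fin n} (h : p.rel (p.defect i) y) :
    y = p.defect i :=
  (mem_defects_iff _ _).1 (Finset.orderEmbOfFin_mem _ _ i) y h

theorem exists_defect (p : LinkState n t) {x : Fin n} (h : x ∈ defects p.rel) :
    ∃ i, p.defect i = x := by
  have : x ∈ Set.range p.defect := by
    rw [defect, Finset.range_orderEmbOfFin]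
    exact h
  exact this

theorem defect_or (p : LinkState n t) (x : Fin n) :
    (∃ i, p.defect i = x) ∨ ∃ y, y ≠ x ∧ p.rel x y ∧ ∀ z, p.rel x z → z = x ∨ z = y := by
  rcases p.card_part x with h | h
  · left
    refine p.exists_defect ?_
    simpa [defects] using h
  · right
    obtain ⟨a, b, hab, h⟩ := Set.ncard_eq_two.1 h
    have hmem : ∀ y, p.rel x y ↔ y = a ∨ y = b := fun y => by
      have : y ∈ {y | p.rel x y} ↔ y ∈ ({a, b} : Set (Fin n)) := by rw [h]
      simpa using this
    rcases (hmem x).1 (p.rel.refl' x) with rfl | rfl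
    · exact ⟨b, hab.symm, (hmem b).2 (Or.inr rfl), fun z hz => (hmem z).1 hz⟩
    · exact ⟨a, hab, (hmem a).2 (Or.inl rfl), fun z hz => ((hmem z).1 hz).symm⟩

/-- The relation of the diagram `C_{p,q}^σ`. -/
def diagramRel (p : LinkState n t) (σ : Equiv.Perm (Fin t)) (q : LinkState n t) :
    Fin n ⊕ Fin n → Fin n ⊕ Fin n → Prop
  | Sum.inl x, Sum.inl y => p.rel x y
  | Sum.inr x, Sum.inr y => q.rel x y
  | Sum.inl x, Sum.inr y => ∃ i, p.defect (σ i) = x ∧ q.defect i = y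
  | Sum.inr y, Sum.inl x => ∃ i, p.defect (σ i) = x ∧ q.defect i = y

/-- The diagram `C_{p,q}^σ`: it restricts to `p` on the left and to `q` on the right, and joins
the `σ(i)`-th defect of `p` to the `i`-th defect of `q`. -/
def diagram (p : LinkState n t) (σ : Equiv.Perm (Fin t)) (q : LinkState n t) : Diagram n :=
  ⟨{ r := diagramRel p σ q
     iseqv :=
      { refl := by
          rintro (x | x)
          · exact p.rel.refl' x
          · exact q.rel.refl' x
        symm := by
          rintro (x | x) (y | y) h
          · exact p.rel.symm' h
          · exact h
          · exact h
          · exact q.rel.symm' h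
        trans := by
          rintro (x | x) (y | y) (z | z) h h'
          · exact p.rel.trans' h h'
          · obtain ⟨i, rfl, rfl⟩ := h'
            obtain rfl := p.eq_of_rel_defect (p.rel.symm' h)
            exact ⟨i, rfl, rfl⟩
          · obtain ⟨i, rfl, rfl⟩ := h
            obtain ⟨j, rfl, hj⟩ := h'
            obtain rfl := q.defect.injective hj
            exact p.rel.refl' _
          · obtain ⟨i, rfl, rfl⟩ := h
            obtain rfl := q.eq_of_rel_defect h'
            exact ⟨i, rfl, rfl⟩
          · obtain ⟨i, rfl, rfl⟩ := h
            obtain rfl := p.eq_of_rel_defect h'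
            exact ⟨i, rfl, rfl⟩
          · obtain ⟨i, rfl, rfl⟩ := h
            obtain ⟨j, hj, rfl⟩ := h'
            obtain rfl := σ.injective (p.defect.injective hj)
            exact q.rel.refl' _
          · obtain ⟨i, rfl, rfl⟩ := h'
            obtain rfl := q.eq_of_rel_defect (q.rel.symm' h)
            exact ⟨i, rfl, rfl⟩
          · exact q.rel.trans' h h' } }, by
    rw [isPairing_iff]
    rintro (x | x)
    · rcases p.defect_or x with ⟨i, rfl⟩ | ⟨y, hne, hy, hu⟩
      · refine ⟨Sum.inr (q.defect (σ.symm i)), ⟨Sum.inr_ne_inl, σ.symm i, by simp, rfl⟩, ?_⟩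
        rintro (z | z) ⟨h1, h2⟩
        · exact (h1 (congrArg Sum.inl (p.eq_of_rel_defect h2))).elim
        · obtain ⟨j, hj, rfl⟩ := h2
          rw [← p.defect.injective hj, Equiv.symm_apply_apply]
      · refine ⟨Sum.inl y, ⟨fun h => hne (Sum.inl_injective h), hy⟩, ?_⟩
        rintro (z | z) ⟨h1, h2⟩
        · exact congrArg Sum.inl ((hu z h2).resolve_left fun h => h1 (congrArg Sum.inl h))
        · obtain ⟨j, rfl, -⟩ := h2
          exact (hne (p.eq_of_rel_defect hy)).elim
    · rcases q.defect_or x with ⟨i, rfl⟩ | ⟨y, hne, hy, hu⟩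
      · refine ⟨Sum.inl (p.defect (σ i)), ⟨Sum.inl_ne_inr, i, rfl, rfl⟩, ?_⟩
        rintro (z | z) ⟨h1, h2⟩
        · obtain ⟨j, rfl, hj⟩ := h2
          rw [q.defect.injective hj]
        · exact (h1 (congrArg Sum.inr (q.eq_of_rel_defect h2))).elim
      · refine ⟨Sum.inr y, ⟨fun h => hne (Sum.inr_injective h), hy⟩, ?_⟩
        rintro (z | z) ⟨h1, h2⟩
        · obtain ⟨j, -, rfl⟩ := h2
          exact (hne (q.eq_of_rel_defect hy)).elim
        · exact congrArg Sum.inr ((hu z h2).resolve_left fun h => h1 (congrArg Sum.inr h))⟩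

theorem through_diagram (p : LinkState n t) (σ : Equiv.Perm (Fin t)) (q : LinkState n t) :
    (diagram p σ q).through = t := by
  have h : {i | ∃ j, (diagram p σ q).1 (Sum.inl i) (Sum.inr j)} = Set.range p.defect := by
    ext i
    constructor
    · rintro ⟨j, k, rfl, -⟩
      exact ⟨_, rfl⟩
    · rintro ⟨k, rfl⟩
      exact ⟨_, σ.symm k, by simp, rfl⟩
  rw [Diagram.through, h, ← Set.image_univ, Set.ncard_image_of_injective _ p.defect.injective,
    Set.ncard_univ, Nat.card_eq_fintype_card, Fintype.card_fin]

variable {t₁ t₂ : ℕ}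

/-- The pair graph of two link states: the edges of `q` together with the edges of `p`. -/
def pairGraph (q : LinkState n t₁) (p : LinkState n t₂) : SimpleGraph (Fin n) where
  Adj x y := x ≠ y ∧ (q.rel x y ∨ p.rel x y)
  symm := ⟨fun _ _ h => ⟨h.1.symm, h.2.imp q.rel.symm' p.rel.symm'⟩⟩
  loopless := ⟨fun _ h => h.1 rfl⟩

/-- The pair set: the components of the pair graph that contain a defect of `q` and a
defect of `p`. -/
def pairSet (q : LinkState n t₁) (p : LinkState n t₂) :
    Set (pairGraph q p).ConnectedComponent :=
  Set.range (fun i => (pairGraph q p).connectedComponentMk (q.defect i)) ∩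
    Set.range (fun i => (pairGraph q p).connectedComponentMk (p.defect i))

/-- The components of the pair graph that contain neither a defect of `q` nor one of `p`. -/
def pairLoops (q : LinkState n t₁) (p : LinkState n t₂) :
    Set (pairGraph q p).ConnectedComponent :=
  (Set.range (fun i => (pairGraph q p).connectedComponentMk (q.defect i)) ∪
    Set.range (fun i => (pairGraph q p).connectedComponentMk (p.defect i)))ᶜ

end LinkState

end LinkStates

end Brauer

namespace NoncommTor

universe u

open CategoryTheory TensorProduct MulOpposite

section Tensor

variable (R : Type u) [CommRing R]

/-- The relations `m s ⊗ x = m ⊗ s x`. -/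
def relations (S M N : Type u) [Ring S] [AddCommGroup M] [Module R M] [Module Sᵐᵒᵖ M]
    [AddCommGroup N] [Module S N] : Submodule R (M ⊗[ℤ] N) :=
  Submodule.span R {z | ∃ (m : M) (s : S) (x : N), z = (op s • m) ⊗ₜ[ℤ] x - m ⊗ₜ[ℤ] (s • x)}

/-- The tensor product `M ⊗_S N` of a right `S`-module `M` and a left `S`-module `N`, as an
`R`-module through `M`. -/
abbrev Tensor (S M N : Type u) [Ring S] [AddCommGroup M] [Module R M] [Module Sᵐᵒᵖ M]
    [AddCommGroup N] [Module S N] : Type u := (M ⊗[ℤ] N) ⧸ relations R S M N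

variable {S S' M M' N N' : Type u} [Ring S] [Ring S']
  [AddCommGroup M] [Module R M] [Module Sᵐᵒᵖ M] [AddCommGroup M'] [Module R M'] [Module S'ᵐᵒᵖ M']
  [AddCommGroup N] [Module S N] [AddCommGroup N'] [Module S' N']

/-- The map `M ⊗_S N → M' ⊗_{S'} N'` induced by a ring homomorphism `f : S → S'` and by
`f`-linear maps `g : M → M'` and `h : N → N'`. -/
def Tensor.map (f : S →+* S') (g : M →ₗ[R] M') (hg : ∀ s m, g (op s • m) = op (f s) • g m)
    (h : N →ₛₗ[f] N') : Tensor R S M N →ₗ[R] Tensor R S' M' N' :=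
  Submodule.mapQ _ _ (AlgebraTensorModule.map g h.toAddMonoidHom.toIntLinearMap) (by
    rw [relations, Submodule.span_le]
    rintro _ ⟨m, s, x, rfl⟩
    refine Submodule.subset_span ⟨g m, f s, h x, ?_⟩
    simp [hg])

theorem Tensor.map_mk (f : S →+* S') (g : M →ₗ[R] M') (hg : ∀ s m, g (op s • m) = op (f s) • g m)
    (h : N →ₛₗ[f] N') (m : M) (x : N) :
    Tensor.map R f g hg h (Submodule.Quotient.mk (m ⊗ₜ[ℤ] x)) =
      Submodule.Quotient.mk (g m ⊗ₜ[ℤ] h x) := rfl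

theorem Tensor.hom_ext {P : Type u} [AddCommGroup P] [Module R P] {φ ψ : Tensor R S M N →ₗ[R] P}
    (h : ∀ m x, φ (Submodule.Quotient.mk (m ⊗ₜ[ℤ] x)) = ψ (Submodule.Quotient.mk (m ⊗ₜ[ℤ] x))) :
    φ = ψ := by
  refine Submodule.linearMap_qext _ ?_
  refine AlgebraTensorModule.ext fun m x => h m x

/-- The functor `M ⊗_S -` from left `S`-modules to `R`-modules. -/
noncomputable def tensorFunctor (S M : Type u) [Ring S] [AddCommGroup M] [Module R M] [Module Sᵐᵒᵖ M] :
    ModuleCat.{u} S ⥤ ModuleCat.{u} R where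
  obj N := ModuleCat.of R (Tensor R S M N)
  map h := ModuleCat.ofHom (Tensor.map R (RingHom.id S) LinearMap.id (fun _ _ => rfl) h.hom)
  map_id N := by
    ext1
    exact Tensor.hom_ext R fun m x => rfl
  map_comp h h' := by
    ext1
    exact Tensor.hom_ext R fun m x => rfl

instance (S M : Type u) [Ring S] [AddCommGroup M] [Module R M] [Module Sᵐᵒᵖ M] :
    (tensorFunctor R S M).Additive where
  map_add {N N'} {h h'} := by
    ext1
    refine Tensor.hom_ext R fun m x => ?_
    change Submodule.Quotient.mk (m ⊗ₜ[ℤ] (h.hom x + h'.hom x)) = _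
    rw [tmul_add]
    rfl

/-- `Tor_i^S(M, N)` for a right `S`-module `M` and a left `S`-module `N`: the left derived
functors of `M ⊗_S -`. -/
noncomputable def Tor (S M N : Type u) [Ring S] [AddCommGroup M] [Module R M] [Module Sᵐᵒᵖ M]
    [AddCommGroup N] [Module S N] (i : ℕ) : ModuleCat.{u} R :=
  ((tensorFunctor R S M).leftDerived i).obj (ModuleCat.of S N)

end Tensor

section Lift

variable {S S' : Type u} [Ring S] [Ring S'] (f : S →+* S')

/-- A chain complex of `S'`-modules regarded as one of `S`-modules. -/
noncomputable abbrev restrict (K : ChainComplex (ModuleCat.{u} S') ℕ) :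
    ChainComplex (ModuleCat.{u} S) ℕ :=
  ((ModuleCat.restrictScalars f).mapHomologicalComplex _).obj K

variable {N : ModuleCat.{u} S} {N' : ModuleCat.{u} S'}
  (h : N ⟶ (ModuleCat.restrictScalars f).obj N')
  (P : ProjectiveResolution N) (Q : ProjectiveResolution N')

theorem exact_restrict {K : ShortComplex (ModuleCat.{u} S')} (hK : K.Exact) :
    (K.map (ModuleCat.restrictScalars f)).Exact :=
  (ShortComplex.moduleCat_exact_iff _).2 fun x hx => (ShortComplex.moduleCat_exact_iff K).1 hK x hx

theorem epi_restrict {A B : ModuleCat.{u} S'} (φ : A ⟶ B) [Epi φ] :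
    Epi ((ModuleCat.restrictScalars f).map φ) :=
  (ModuleCat.epi_iff_surjective _).2 ((ModuleCat.epi_iff_surjective φ).1 inferInstance)

/-- The augmentation `P₀ → N` of a resolution. -/
noncomputable def aug : P.complex.X 0 ⟶ N := P.π.f 0

theorem d_aug : P.complex.d 1 0 ≫ aug P = 0 := P.complex_d_comp_π_f_zero

instance : Epi (aug P) := inferInstanceAs (Epi (P.π.f 0))

theorem exact_aug : (ShortComplex.mk _ _ (d_aug P)).Exact := P.exact₀

/-- Degree zero of the comparison map. -/
noncomputable def liftZero : P.complex.X 0 ⟶ (ModuleCat.restrictScalars f).obj (Q.complex.X 0) :=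
  haveI := epi_restrict f (aug Q)
  Projective.factorThru (aug P ≫ h) ((ModuleCat.restrictScalars f).map (aug Q))

theorem liftZero_comp : liftZero f h P Q ≫ (ModuleCat.restrictScalars f).map (aug Q) =
    aug P ≫ h :=
  haveI := epi_restrict f (aug Q)
  Projective.factorThru_comp _ _

theorem exists_lift : ∃ φ : P.complex ⟶ restrict f Q.complex,
    φ.f 0 ≫ (ModuleCat.restrictScalars f).map (aug Q) = aug P ≫ h := by
  have e0 := exact_restrict f (exact_aug Q)
  have e1 := fun n => exact_restrict f (Q.exact_succ n)
  have z : (P.complex.d 1 0 ≫ liftZero f h P Q) ≫ (ModuleCat.restrictScalars f).map (aug Q) = 0 := by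
    rw [Category.assoc, liftZero_comp, ← Category.assoc, d_aug, Limits.zero_comp]
  refine ⟨ChainComplex.mkHom _ _ (liftZero f h P Q)
    (e0.liftFromProjective (P.complex.d 1 0 ≫ liftZero f h P Q) z)
    (e0.liftFromProjective_comp _ z) (fun n p => ?_), ?_⟩
  · have w : (P.complex.d (n + 2) (n + 1) ≫ p.2.1) ≫
        (restrict f Q.complex).d (n + 1) n = 0 := by
      rw [Category.assoc, p.2.2, ← Category.assoc, P.complex.d_comp_d, Limits.zero_comp]
    exact ⟨(e1 n).liftFromProjective (P.complex.d (n + 2) (n + 1) ≫ p.2.1) w,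
      (e1 n).liftFromProjective_comp _ w⟩
  · exact liftZero_comp f h P Q

end Lift

section Map

variable (R : Type u) [CommRing R] {S S' M M' N N' : Type u} [Ring S] [Ring S']
  [AddCommGroup M] [Module R M] [Module Sᵐᵒᵖ M] [AddCommGroup M'] [Module R M'] [Module S'ᵐᵒᵖ M']
  [AddCommGroup N] [Module S N] [AddCommGroup N'] [Module S' N']

/-- A morphism of `S`-modules into a restricted `S'`-module is a semilinear map. -/
noncomputable def toSemilinear {f : S →+* S'} {X : ModuleCat.{u} S} {Y : ModuleCat.{u} S'}
    (φ : X ⟶ (ModuleCat.restrictScalars f).obj Y) : X →ₛₗ[f] Y where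
  toFun x := φ.hom x
  map_add' x y := map_add φ.hom x y
  map_smul' s x := map_smul φ.hom s x

/-- A semilinear map is a morphism of `S`-modules into the restricted `S'`-module. -/
noncomputable def ofSemilinear {f : S →+* S'} (h : N →ₛₗ[f] N') :
    ModuleCat.of S N ⟶ (ModuleCat.restrictScalars f).obj (ModuleCat.of S' N') :=
  ModuleCat.ofHom (Y := (ModuleCat.restrictScalars f).obj (ModuleCat.of S' N'))
    { toFun := fun x => h x
      map_add' := fun x y => map_add h x y
      map_smul' := fun s x => map_smulₛₗ h s x }

/-- The chain map `M ⊗_S K → M' ⊗_{S'} L` induced by `f : S → S'`, an `f`-linear map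
`g : M → M'` and an `f`-linear chain map `φ : K → L`. -/
noncomputable def tensorChainMap (f : S →+* S') (g : M →ₗ[R] M')
    (hg : ∀ s m, g (op s • m) = op (f s) • g m)
    {K : ChainComplex (ModuleCat.{u} S) ℕ} {L : ChainComplex (ModuleCat.{u} S') ℕ}
    (φ : K ⟶ restrict f L) :
    ((tensorFunctor R S M).mapHomologicalComplex _).obj K ⟶
      ((tensorFunctor R S' M').mapHomologicalComplex _).obj L where
  f i := ModuleCat.ofHom (Tensor.map R f g hg (toSemilinear (φ.f i)))
  comm' i j _ := by
    ext1
    refine Tensor.hom_ext R fun m x => ?_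
    have h := congrArg (fun ψ => ψ.hom x) (φ.comm i j)
    exact congrArg (fun y => (Submodule.Quotient.mk (g m ⊗ₜ[ℤ] y) :
      Tensor R S' M' (L.X j))) h

/-- The change of rings map `Tor_i^S(M, N) → Tor_i^{S'}(M', N')` induced by a ring homomorphism
`f : S → S'` and `f`-linear maps `g : M → M'`, `h : N → N'`: lift `h` to an `f`-linear chain map
of projective resolutions, tensor it with `g`, and take homology. -/
noncomputable def Tor.map (f : S →+* S') (g : M →ₗ[R] M')
    (hg : ∀ s m, g (op s • m) = op (f s) • g m) (h : N →ₛₗ[f] N') (i : ℕ) :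
    Tor R S M N i ⟶ Tor R S' M' N' i :=
  let P := projectiveResolution (ModuleCat.of S N)
  let Q := projectiveResolution (ModuleCat.of S' N')
  (P.isoLeftDerivedObj (tensorFunctor R S M) i).hom ≫
    HomologicalComplex.homologyMap
      (tensorChainMap R f g hg (exists_lift f (ofSemilinear h) P Q).choose) i ≫
    (Q.isoLeftDerivedObj (tensorFunctor R S' M') i).inv

end Map

section Trivial

variable {R : Type u} [CommRing R] {S S' : Type u} [Ring S] [Algebra R S] [Ring S'] [Algebra R S']

/-- The trivial module of an augmented algebra: the ground ring `R`, on which the algebra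
acts on both sides through the augmentation. -/
def Trivial (_ε : S →ₐ[R] R) : Type u := R

variable (ε : S →ₐ[R] R) (ε' : S' →ₐ[R] R)

instance : AddCommGroup (Trivial ε) := inferInstanceAs (AddCommGroup R)

instance : Module R (Trivial ε) := inferInstanceAs (Module R R)

instance : Module S (Trivial ε) := Module.compHom R (ε : S →+* R)

instance : Module Sᵐᵒᵖ (Trivial ε) :=
  Module.compHom R ((ε : S →+* R).fromOpposite fun _ _ => Commute.all _ _)

theorem smul_trivial (s : S) (r : Trivial ε) : s • r = ε s • r := rfl

theorem op_smul_trivial (s : S) (r : Trivial ε) : op s • r = ε s • r := rfl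

/-- The identity map of `R` as a map between trivial modules. -/
def Trivial.id : Trivial ε →ₗ[R] Trivial ε' := (LinearMap.id : R →ₗ[R] R)

/-- For a homomorphism `f : S → S'` of augmented algebras, the map
`Tor_i^S(1, 1) → Tor_i^{S'}(1, 1)` induced by `f` and the identity of the trivial module. -/
noncomputable def Tor.trivialMap (f : S →ₐ[R] S') (hf : ε'.comp f = ε) (i : ℕ) :
    Tor R S (Trivial ε) (Trivial ε) i ⟶ Tor R S' (Trivial ε') (Trivial ε') i :=
  have key : ∀ s (m : Trivial ε), Trivial.id ε ε' (ε s • m) = ε' (f s) • Trivial.id ε ε' m :=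
    fun s m => by rw [map_smul, ← hf]; rfl
  Tor.map R (f : S →+* S') (Trivial.id ε ε') key
    { toFun := Trivial.id ε ε'
      map_add' := map_add (Trivial.id ε ε')
      map_smul' := key } i

end Trivial

end NoncommTor


namespace Brauer

universe u

section Restriction

variable {R : Type u} [CommRing R] {n : ℕ} {δ : R}

/-- The subalgebra `A` of `Br_n(δ)` is obtained by restriction to the sets `M' t` of link states
and the subgroups `G' t` of the symmetric groups: the diagrams `C_{p,q}^σ` with
`p, q ∈ M' t` and `σ ∈ G' t`, for all `t`, form an `R`-basis of `A`. -/
def ObtainedByRestriction (A : Subalgebra R (BrauerAlgebra R n δ))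
    (M' : ∀ t, Set (LinkState n t)) (G' : ∀ t, Subgroup (Equiv.Perm (Fin t))) : Prop :=
  ∃ b : Module.Basis (Σ t : ℕ, M' t × G' t × M' t) R A,
    ∀ (t : ℕ) (p : M' t) (σ : G' t) (q : M' t),
      (b ⟨t, p, σ, q⟩ : BrauerAlgebra R n δ) = BrauerAlgebra.of R δ (LinkState.diagram p.1 σ.1 q.1)

variable {A : Subalgebra R (BrauerAlgebra R n δ)} {M' : ∀ t, Set (LinkState n t)}
  {G' : ∀ t, Subgroup (Equiv.Perm (Fin t))}

/-- The `R`-submodule of `A` spanned by the basis diagrams with at most `a` left-to-right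
connections. -/
noncomputable def spanLE (A : Subalgebra R (BrauerAlgebra R n δ)) (M' : ∀ t, Set (LinkState n t))
    (G' : ∀ t, Subgroup (Equiv.Perm (Fin t))) (a : ℤ) : Submodule R A :=
  Submodule.span R {x | ∃ t : ℕ, (t : ℤ) ≤ a ∧ ∃ p ∈ M' t, ∃ σ ∈ G' t, ∃ q ∈ M' t,
    (x : BrauerAlgebra R n δ) = BrauerAlgebra.of R δ (LinkState.diagram p σ q)}

theorem spanLE_mono {a b : ℤ} (hab : a ≤ b) : spanLE A M' G' a ≤ spanLE A M' G' b :=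
  Submodule.span_mono fun _ ⟨t, ht, h⟩ => ⟨t, ht.trans hab, h⟩

/-- The span in `Br_n(δ)` of the diagrams with at most `a` left-to-right connections. -/
noncomputable def ambientLE (R : Type u) [CommRing R] (n : ℕ) (δ : R) (a : ℤ) :
    Submodule R (BrauerAlgebra R n δ) :=
  Submodule.span R (BrauerAlgebra.of R δ '' {d | (d.through : ℤ) ≤ a})

theorem mem_ambientLE {a : ℤ} {x : BrauerAlgebra R n δ} :
    x ∈ ambientLE R n δ a ↔
      ∀ d : Diagram n, a < d.through → (BrauerAlgebra.basis R n δ).repr x d = 0 := by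
  unfold ambientLE
  refine ((BrauerAlgebra.basis R n δ).mem_span_image).trans ?_
  constructor
  · intro h d hd
    by_contra hne
    have : (d.through : ℤ) ≤ a := h (Finsupp.mem_support_iff.2 hne)
    omega
  · intro h d hd
    by_contra hne
    exact Finsupp.mem_support_iff.1 hd (h d (not_le.1 hne))

theorem mul_mem_ambientLE {a : ℤ} (x : BrauerAlgebra R n δ) {y : BrauerAlgebra R n δ}
    (hy : y ∈ ambientLE R n δ a) : x * y ∈ ambientLE R n δ a := by
  unfold ambientLE at hy
  induction hy using Submodule.span_induction with
  | zero => rw [mul_zero]; exact zero_mem _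
  | add y z _ _ hy hz => rw [mul_add]; exact add_mem hy hz
  | smul r y _ hy => rw [mul_smul_comm]; exact Submodule.smul_mem _ _ hy
  | mem y hy =>
    obtain ⟨e, he, rfl⟩ := hy
    induction x using BrauerAlgebra.induction with
    | hadd x x' hx hx' => rw [add_mul]; exact add_mem hx hx'
    | hsmul r x hx => rw [smul_mul_assoc]; exact Submodule.smul_mem _ _ hx
    | hof d =>
      rw [BrauerAlgebra.of_mul_of]
      refine Submodule.smul_mem _ _ (Submodule.subset_span ⟨_, ?_, rfl⟩)
      exact (Int.ofNat_le.2 (Diagram.through_mul_le_right d e)).trans he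

theorem mem_mul_ambientLE {a : ℤ} (x : BrauerAlgebra R n δ) {y : BrauerAlgebra R n δ}
    (hy : y ∈ ambientLE R n δ a) : y * x ∈ ambientLE R n δ a := by
  unfold ambientLE at hy
  induction hy using Submodule.span_induction with
  | zero => rw [zero_mul]; exact zero_mem _
  | add y z _ _ hy hz => rw [add_mul]; exact add_mem hy hz
  | smul r y _ hy => rw [smul_mul_assoc]; exact Submodule.smul_mem _ _ hy
  | mem y hy =>
    obtain ⟨e, he, rfl⟩ := hy
    induction x using BrauerAlgebra.induction with
    | hadd x x' hx hx' => rw [mul_add]; exact add_mem hx hx'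
    | hsmul r x hx => rw [mul_smul_comm]; exact Submodule.smul_mem _ _ hx
    | hof d =>
      rw [BrauerAlgebra.of_mul_of]
      refine Submodule.smul_mem _ _ (Submodule.subset_span ⟨_, ?_, rfl⟩)
      exact (Int.ofNat_le.2 (Diagram.through_mul_le_left e d)).trans he

theorem augmentation_ambientLE {a : ℤ} (ha : a ≤ (n : ℤ) - 1) {x : BrauerAlgebra R n δ}
    (hx : x ∈ ambientLE R n δ a) : BrauerAlgebra.augmentation R n δ x = 0 := by
  unfold ambientLE at hx
  induction hx using Submodule.span_induction with
  | zero => exact map_zero _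
  | add y z _ _ hy hz => rw [map_add, hy, hz, add_zero]
  | smul r y _ hy => rw [map_smul, hy, smul_zero]
  | mem y hy =>
    obtain ⟨e, he, rfl⟩ := hy
    rw [BrauerAlgebra.augmentation_of, if_neg]
    intro h
    have : (e.through : ℤ) ≤ a := he
    omega

theorem mem_spanLE_iff (hA : ObtainedByRestriction A M' G') (a : ℤ) (x : A) :
    x ∈ spanLE A M' G' a ↔ (x : BrauerAlgebra R n δ) ∈ ambientLE R n δ a := by
  constructor
  · have : spanLE A M' G' a ≤ (ambientLE R n δ a).comap A.val.toLinearMap := by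
      refine Submodule.span_le.2 ?_
      rintro y ⟨t, ht, p, -, σ, -, q, -, hy⟩
      refine Submodule.subset_span ⟨LinkState.diagram p σ q, ?_, hy.symm⟩
      rw [Set.mem_ofPred_eq, LinkState.through_diagram]
      exact ht
    exact fun h => this h
  · intro hx
    rcases subsingleton_or_nontrivial R with hR | hR
    · have := Module.subsingleton R A
      rw [Subsingleton.elim x 0]
      exact zero_mem _
    obtain ⟨b, hb⟩ := hA
    have hb' : ∀ i, (b i : BrauerAlgebra R n δ) =
        BrauerAlgebra.basis R n δ (LinkState.diagram i.2.1.1 i.2.2.1.1 i.2.2.2.1) :=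
      fun i => hb i.1 i.2.1 i.2.2.1 i.2.2.2
    have hcoef : ∀ i, b.repr x i = (BrauerAlgebra.basis R n δ).repr (x : BrauerAlgebra R n δ)
        (LinkState.diagram i.2.1.1 i.2.2.1.1 i.2.2.2.1) := by
      classical
      intro i
      have h : b.coord i = ((BrauerAlgebra.basis R n δ).coord
          (LinkState.diagram i.2.1.1 i.2.2.1.1 i.2.2.2.1)).comp A.val.toLinearMap := by
        refine b.ext fun j => ?_
        change b.repr (b j) i = (BrauerAlgebra.basis R n δ).repr (b j : BrauerAlgebra R n δ) _
        rw [hb', Module.Basis.repr_self, Module.Basis.repr_self, Finsupp.single_apply,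
          Finsupp.single_apply]
        refine if_congr ⟨fun h => by rw [h], fun h => ?_⟩ rfl rfl
        refine b.injective (Subtype.ext ?_)
        rw [hb', hb', h]
      exact LinearMap.congr_fun h x
    rw [← b.linearCombination_repr x, Finsupp.linearCombination_apply]
    refine Submodule.sum_mem _ fun i _ => ?_
    by_cases hi : (i.1 : ℤ) ≤ a
    · exact Submodule.smul_mem _ _ (Submodule.subset_span ⟨i.1, hi, i.2.1.1, i.2.1.2,
        i.2.2.1.1, i.2.2.1.2, i.2.2.2.1, i.2.2.2.2, hb' i⟩)
    · have h0 : b.repr x i = 0 := by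
        rw [hcoef]
        refine mem_ambientLE.1 hx _ ?_
        rw [LinkState.through_diagram]
        exact not_le.1 hi
      change b.repr x i • b i ∈ _
      rw [h0, zero_smul]
      exact zero_mem _

/-- The twosided ideal `I_{≤ a}` of `A`, spanned by the basis diagrams with at most `a`
left-to-right connections. -/
noncomputable def idealLE (hA : ObtainedByRestriction A M' G') (a : ℤ) : Ideal A where
  carrier := spanLE A M' G' a
  add_mem' := add_mem
  zero_mem' := zero_mem _
  smul_mem' := fun x y hy =>
    (mem_spanLE_iff hA a (x * y)).2 (mul_mem_ambientLE _ ((mem_spanLE_iff hA a y).1 hy))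

theorem mem_idealLE (hA : ObtainedByRestriction A M' G') (a : ℤ) (x : A) :
    x ∈ idealLE hA a ↔ x ∈ spanLE A M' G' a := Iff.rfl

instance (hA : ObtainedByRestriction A M' G') (a : ℤ) : (idealLE hA a).IsTwoSided :=
  ⟨fun {y} x hy =>
    (mem_spanLE_iff hA a (y * x)).2 (mem_mul_ambientLE _ ((mem_spanLE_iff hA a y).1 hy))⟩

theorem idealLE_mono (hA : ObtainedByRestriction A M' G') {a b : ℤ} (hab : a ≤ b) :
    idealLE hA a ≤ idealLE hA b := fun _ hx => spanLE_mono hab hx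

/-- The augmentation of `A / I_{≤ a}` for `a ≤ n - 1`, which defines its trivial module: it is
induced by the augmentation of `Br_n(δ)`. -/
noncomputable def quotientAugmentation (hA : ObtainedByRestriction A M' G') (a : ℤ)
    (ha : a ≤ (n : ℤ) - 1) : (A ⧸ idealLE hA a) →ₐ[R] R :=
  Ideal.Quotient.liftₐ (idealLE hA a) ((BrauerAlgebra.augmentation R n δ).comp A.val)
    fun x hx => augmentation_ambientLE ha ((mem_spanLE_iff hA a x).1 hx)

theorem quotientAugmentation_mk (hA : ObtainedByRestriction A M' G') (a : ℤ)
    (ha : a ≤ (n : ℤ) - 1) (x : A) :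
    quotientAugmentation hA a ha (Ideal.Quotient.mk (idealLE hA a) x) =
      BrauerAlgebra.augmentation R n δ (x : BrauerAlgebra R n δ) :=
  Ideal.Quotient.liftₐ_apply _ _ _ _

/-- The quotient map `A / I_{≤ a} → A / I_{≤ b}` for `a ≤ b`. -/
noncomputable def quotientMap (hA : ObtainedByRestriction A M' G') {a b : ℤ} (hab : a ≤ b) :
    (A ⧸ idealLE hA a) →ₐ[R] (A ⧸ idealLE hA b) :=
  Ideal.Quotient.factorₐ R (idealLE_mono hA hab)

theorem quotientMap_mk (hA : ObtainedByRestriction A M' G') {a b : ℤ} (hab : a ≤ b) (x : A) :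
    quotientMap hA hab (Ideal.Quotient.mk (idealLE hA a) x) = Ideal.Quotient.mk (idealLE hA b) x :=
  Ideal.Quotient.factor_mk (idealLE_mono hA hab) x

theorem augmentation_comp_quotientMap (hA : ObtainedByRestriction A M' G') {a b : ℤ}
    (hab : a ≤ b) (hb : b ≤ (n : ℤ) - 1) :
    (quotientAugmentation hA b hb).comp (quotientMap hA hab) =
      quotientAugmentation hA a (hab.trans hb) := by
  refine AlgHom.ext fun x => ?_
  obtain ⟨x, rfl⟩ := Ideal.Quotient.mk_surjective x
  rw [AlgHom.comp_apply, quotientMap_mk, quotientAugmentation_mk, quotientAugmentation_mk]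

/-- The map `Tor_i(1, 1) → Tor_i(1, 1)` over `A / I_{≤ a}` and `A / I_{≤ b}` that is induced by
the quotient map `A / I_{≤ a} → A / I_{≤ b}`. -/
noncomputable def quotientTorMap (hA : ObtainedByRestriction A M' G') {a b : ℤ} (hab : a ≤ b)
    (hb : b ≤ (n : ℤ) - 1) (i : ℕ) :
    NoncommTor.Tor R (A ⧸ idealLE hA a)
        (NoncommTor.Trivial (quotientAugmentation hA a (hab.trans hb)))
        (NoncommTor.Trivial (quotientAugmentation hA a (hab.trans hb))) i ⟶
      NoncommTor.Tor R (A ⧸ idealLE hA b)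
        (NoncommTor.Trivial (quotientAugmentation hA b hb))
        (NoncommTor.Trivial (quotientAugmentation hA b hb)) i :=
  NoncommTor.Tor.trivialMap (quotientAugmentation hA a (hab.trans hb))
    (quotientAugmentation hA b hb) (quotientMap hA hab)
    (augmentation_comp_quotientMap hA hab hb) i

/-- Hypothesis (†) at `t`: every `q ∈ M' t` has a partner `p ∈ M' t` such that the pair set has
cardinality `t` and `δ ^ i` is invertible, where `i` is the number of components of the pair
graph that contain no defect of `q` and no defect of `p`. -/
def HypothesisDagger (δ : R) (M' : ∀ t, Set (LinkState n t)) (t : ℕ) : Prop :=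
  ∀ q ∈ M' t, ∃ p ∈ M' t, (LinkState.pairSet q p).ncard = t ∧
    IsUnit (δ ^ (LinkState.pairLoops q p).ncard)

end Restriction

end Brauer

/-!
Write `A_a = A / I_{≤ a}`, and let `J = I_{≤ t} / I_{≤ t - 1}`, an ideal of `A_{t-1}`.

Hypothesis (†) at `t` gives, for every `q ∈ M' t`, an element `e_q ∈ I_{≤ t}` with
`C^σ_{x,q} e_q = C^σ_{x,q}` for all `x` and `σ` (`exists_right_identity`). If `p` is a partner of
`q`, the pair graph matches the defects of `p` with those of `q` by a permutation `π`, so that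
`C^σ_{x,q} C^τ_{p,y}` is a unit times `C^{σπτ}_{x,y}`, and `e_q` is a multiple of `C^{π⁻¹}_{p,q}`;
the latter diagram lies in `A` because `π⁻¹` is a power of `π`. Left multiplication preserves the
right-hand side of a diagram modulo `I_{≤ t - 1}`. Hence `J` is the direct sum over `q ∈ M' t` of
the left ideals generated by the `e_q`, and an element of `J` with components `x_q ∈ J` is
`∑ x_q e_q`. So `J` is projective as a left module, and idempotent (`HasDualBasis`).

Since `J` is idempotent and acts as zero on the trivial module `1`, the tensor product of `1` with
any sum of copies of `J` vanishes. The sequences `0 → J^X → A_{t-1}^X → A_t^X → 0` therefore show,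
by induction on `t`, that projective `A_b`-modules are acyclic for `1 ⊗ -` over `A_a`
(`extAcyclic_comp`, `extAcyclic_quotientMap`), and so a projective resolution of `1` over `A_b`
computes `Tor` over `A_a` too (`isIso_trivialMap`).

Acyclicity is expressed through `Ext` instead of `Tor`: for the character module
`1* = Hom_ℤ(1, ℚ/ℤ)` the group `Ext^i(N, 1*)` is the character group of `Tor_i(1, N)`, and the
long exact sequences of `Ext` are available. Only the case `i = 0` of this duality enters, in the
form that characters of `1 ⊗ N` are module maps `N → 1*` (`charHom`, `charEval_eq_zero`).
-/

/-! ### Acyclic modules -/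

namespace CategoryTheory.Abelian

open Limits Ext

universe w v u

variable {𝒞 : Type u} [Category.{v} 𝒞] [Abelian 𝒞] [HasExt.{w} 𝒞]

/-- `N` is acyclic for `Hom(-, Y)`: all `Ext^i(N, Y)` with `i > 0` vanish. -/
def ExtAcyclic (Y N : 𝒞) : Prop := ∀ (i : ℕ) (x : Ext N Y (i + 1)), x = 0

namespace ExtAcyclic

variable {Y N N' : 𝒞}

theorem of_projective [Projective N] : ExtAcyclic Y N := fun _ x => x.eq_zero_of_projective

theorem of_retract (h : ExtAcyclic Y N) (r : Retract N' N) : ExtAcyclic Y N' := by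
  intro i x
  have h1 : (mk₀ r.i).comp ((mk₀ r.r).comp x (zero_add _)) (zero_add _) = x := by
    rw [mk₀_comp_mk₀_assoc, r.retract, mk₀_id_comp]
  rw [← h1, h i ((mk₀ r.r).comp x (zero_add _)), Ext.comp_zero]

theorem of_iso (h : ExtAcyclic Y N) (e : N' ≅ N) : ExtAcyclic Y N' := h.of_retract e.retract

theorem biprod (h : ExtAcyclic Y N) (h' : ExtAcyclic Y N') : ExtAcyclic Y (N ⊞ N') := fun i x =>
  biprod_ext (by rw [h i (Ext.comp _ x _), Ext.comp_zero]) (by rw [h' i (Ext.comp _ x _), Ext.comp_zero])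

variable {S : ShortComplex 𝒞} (hS : S.ShortExact)

include hS

theorem kernel (h₂ : ExtAcyclic Y S.X₂) (h₃ : ExtAcyclic Y S.X₃) : ExtAcyclic Y S.X₁ := by
  intro i x
  obtain ⟨y, rfl⟩ := contravariant_sequence_exact₁ hS Y x (n₁ := i + 2) (by omega) (h₃ _ _)
  rw [h₂ _ y, Ext.comp_zero]

/-- The cokernel of a monomorphism between acyclic objects is acyclic if its source admits no
nonzero morphism to `Y`. -/
theorem cokernel (h₁ : ExtAcyclic Y S.X₁) (h₂ : ExtAcyclic Y S.X₂) (h : ∀ φ : S.X₁ ⟶ Y, φ = 0) :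
    ExtAcyclic Y S.X₃ := by
  intro i x
  obtain ⟨y, rfl⟩ := contravariant_sequence_exact₃ hS Y x (h₂ _ _) (n₀ := i) (by omega)
  have hy : y = 0 := by
    cases i with
    | zero =>
      obtain ⟨φ, rfl⟩ := (mk₀_bijective _ _).2 y
      rw [h φ, mk₀_zero]
    | succ i => exact h₁ i y
  rw [hy, Ext.comp_zero]

theorem exists_extension (h₃ : ExtAcyclic Y S.X₃) (φ : S.X₁ ⟶ Y) : ∃ ψ : S.X₂ ⟶ Y, S.f ≫ ψ = φ := by
  obtain ⟨y, hy⟩ := contravariant_sequence_exact₁ hS Y (mk₀ φ) (n₁ := 1) (by omega) (h₃ 0 _)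
  obtain ⟨ψ, rfl⟩ := (mk₀_bijective _ _).2 y
  rw [mk₀_comp_mk₀] at hy
  exact ⟨ψ, (mk₀_bijective _ _).1 hy⟩

end ExtAcyclic

theorem ExtAcyclic.prod {B : Type u} [Ring B] {Y N N' : ModuleCat.{u} B} (h : ExtAcyclic Y N)
    (h' : ExtAcyclic Y N') : ExtAcyclic Y (ModuleCat.of B (N × N')) :=
  (h.biprod h').of_iso (ModuleCat.biprodIsoProd N N').symm

end CategoryTheory.Abelian

namespace NoncommTor

open CategoryTheory CategoryTheory.Abelian

universe u

section Resolution

variable {B : Type u} [Ring B] {Y : ModuleCat.{u} B}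

/-- A criterion for a chain map to induce an isomorphism in homology, in terms of elements. -/
theorem isIso_homologyMap {K L : ChainComplex (ModuleCat.{u} B) ℕ} (φ : K ⟶ L) (i : ℕ)
    (inj : ∀ (k : K.X i) (l : L.X (i + 1)), K.d i (i - 1) k = 0 → φ.f i k = L.d (i + 1) i l →
      ∃ k', K.d (i + 1) i k' = k)
    (surj : ∀ l : L.X i, L.d i (i - 1) l = 0 →
      ∃ k l', K.d i (i - 1) k = 0 ∧ φ.f i k + L.d (i + 1) i l' = l) :
    IsIso (HomologicalComplex.homologyMap φ i) := by
  have hprev : (ComplexShape.down ℕ).prev i = i + 1 := ChainComplex.prev ℕ i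
  have hnext : (ComplexShape.down ℕ).next i = i - 1 := by
    cases i with
    | zero => exact ChainComplex.next_nat_zero
    | succ i => exact ChainComplex.next_nat_succ i
  -- every element of degree `i` that the differential kills is given by a cycle
  have hcyc : ∀ (M : ChainComplex (ModuleCat.{u} B) ℕ) (x : M.X i), M.d i (i - 1) x = 0 →
      ∃ z : M.cycles i, M.iCycles i z = x := fun M =>
    (ShortComplex.moduleCat_exact_iff _).1
      (ShortComplex.exact_of_f_is_kernel
        (.mk (M.iCycles i) (M.d i (i - 1)) (M.iCycles_d i (i - 1))) (M.cyclesIsKernel i (i - 1) hnext))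
  have hbd : ∀ (M : ChainComplex (ModuleCat.{u} B) ℕ) (z : M.cycles i), M.homologyπ i z = 0 →
      ∃ y, M.toCycles (i + 1) i y = z := fun M =>
    (ShortComplex.moduleCat_exact_iff _).1
      (ShortComplex.exact_of_g_is_cokernel
        (.mk (M.toCycles (i + 1) i) (M.homologyπ i) (M.toCycles_comp_homologyπ (i + 1) i)) (M.homologyIsCokernel (i + 1) i hprev))
  have hπ : ∀ (M : ChainComplex (ModuleCat.{u} B) ℕ), Function.Surjective (M.homologyπ i) :=
    fun M => (ModuleCat.epi_iff_surjective _).1 inferInstance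
  have hι : ∀ (M : ChainComplex (ModuleCat.{u} B) ℕ), Function.Injective (M.iCycles i) :=
    fun M => (ModuleCat.mono_iff_injective _).1 inferInstance
  have hdz : ∀ (M : ChainComplex (ModuleCat.{u} B) ℕ) z, M.d i (i - 1) (M.iCycles i z) = 0 :=
    fun M z => congrArg (fun f => f.hom z) (M.iCycles_d i (i - 1))
  have htc : ∀ (M : ChainComplex (ModuleCat.{u} B) ℕ) y,
      M.iCycles i (M.toCycles (i + 1) i y) = M.d (i + 1) i y :=
    fun M y => congrArg (fun f => f.hom y) (M.toCycles_i (i + 1) i)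
  have hπ0 : ∀ (M : ChainComplex (ModuleCat.{u} B) ℕ) y,
      M.homologyπ i (M.toCycles (i + 1) i y) = 0 :=
    fun M y => congrArg (fun f => f.hom y) (M.toCycles_comp_homologyπ (i + 1) i)
  have hφπ : ∀ z, HomologicalComplex.homologyMap φ i (K.homologyπ i z) =
      L.homologyπ i (HomologicalComplex.cyclesMap φ i z) :=
    fun z => congrArg (fun f => f.hom z) (HomologicalComplex.homologyπ_naturality φ i)
  have hφι : ∀ z, L.iCycles i (HomologicalComplex.cyclesMap φ i z) = φ.f i (K.iCycles i z) :=
    fun z => congrArg (fun f => f.hom z) (HomologicalComplex.cyclesMap_i φ i)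
  have : Mono (HomologicalComplex.homologyMap φ i) := by
    rw [ModuleCat.mono_iff_injective, injective_iff_map_eq_zero]
    intro x hx
    obtain ⟨z, rfl⟩ := hπ K x
    rw [hφπ] at hx
    obtain ⟨l, hl⟩ := hbd L _ hx
    obtain ⟨k', hk'⟩ := inj (K.iCycles i z) l (hdz K z) (by rw [← hφι, ← hl, htc])
    rw [← htc] at hk'
    rw [← hι K hk', hπ0]
  have : Epi (HomologicalComplex.homologyMap φ i) := by
    rw [ModuleCat.epi_iff_surjective]
    intro y
    obtain ⟨w, rfl⟩ := hπ L y
    obtain ⟨k, l, hk, hl⟩ := surj _ (hdz L w)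
    obtain ⟨z, rfl⟩ := hcyc K k hk
    refine ⟨K.homologyπ i z, ?_⟩
    have hw : HomologicalComplex.cyclesMap φ i z + L.toCycles (i + 1) i l = w :=
      hι L (by rw [map_add, hφι, htc, hl])
    rw [hφπ, ← hw, map_add, hπ0, add_zero]
  exact isIso_of_mono_of_epi _

/-- Let `⋯ → X₂ → X₁ → X₀ → 0` be an exact sequence of modules that are acyclic for `Hom(-, Y)`.
Then the sequence stays exact after applying `Hom(-, Y)`. -/
theorem exists_factor_of_exact (X : ℕ → ModuleCat.{u} B) (d : ∀ k, X (k + 1) ⟶ X k)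
    (hX : ∀ k, ExtAcyclic Y (X k)) (h0 : Function.Surjective (d 0))
    (hd : ∀ k, Function.Exact (d (k + 1)) (d k)) (k : ℕ) (χ : X (k + 1) ⟶ Y)
    (hχ : d (k + 1) ≫ χ = 0) : ∃ ψ : X k ⟶ Y, d k ≫ ψ = χ := by
  -- `Z k` is the module of boundaries in degree `k`
  let Z : ∀ k, Submodule B (X k) := fun k => LinearMap.range (d k).hom
  have ses : ∀ k, (ShortComplex.mk (ModuleCat.ofHom (Z (k + 1)).subtype)
      (ModuleCat.ofHom (d k).hom.rangeRestrict) (by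
        ext ⟨x, hx⟩
        exact ((hd k) x).2 hx)).ShortExact := fun k =>
    { exact := (ShortComplex.moduleCat_exact_iff _).2 fun x hx =>
        ⟨⟨x, ((hd k) x).1 (congrArg Subtype.val hx)⟩, rfl⟩
      mono_f := (ModuleCat.mono_iff_injective _).2 Subtype.val_injective
      epi_g := (ModuleCat.epi_iff_surjective _).2 (LinearMap.surjective_rangeRestrict _) }
  have hZ : ∀ k, ExtAcyclic Y (ModuleCat.of B (Z k)) := by
    intro k
    induction k with
    | zero =>
      refine (hX 0).of_iso (LinearEquiv.toModuleIso
        ((LinearEquiv.ofEq (Z 0) ⊤ (LinearMap.range_eq_top.2 h0)).trans Submodule.topEquiv))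
    | succ k ih => exact ExtAcyclic.kernel (ses k) (hX (k + 1)) ih
  -- `χ` induces a map on the boundaries in degree `k`
  obtain ⟨χ', hχ'⟩ : ∃ χ' : ModuleCat.of B (Z k) ⟶ Y,
      ModuleCat.ofHom (d k).hom.rangeRestrict ≫ χ' = χ :=
    haveI := (ses k).epi_g
    ⟨(ses k).exact.desc χ (by ext ⟨x, y, rfl⟩; exact congrArg (fun f => f.hom y) hχ),
      (ses k).exact.g_desc _ _⟩
  cases k with
  | zero =>
    refine ⟨ModuleCat.ofHom (LinearMap.codRestrict (Z 0) LinearMap.id fun x => h0 x) ≫ χ', ?_⟩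
    rw [← hχ']
    rfl
  | succ k =>
    obtain ⟨ψ, hψ⟩ := ExtAcyclic.exists_extension (ses k) (hZ k) χ'
    refine ⟨ψ, ?_⟩
    rw [← hχ', ← hψ]
    rfl

end Resolution

end NoncommTor

/-! ### Mapping cones and characters of the trivial module -/

namespace NoncommTor

open CategoryTheory CategoryTheory.Abelian TensorProduct MulOpposite

universe u

section Cone

variable {B : Type u} [Ring B] {Y : ModuleCat.{u} B} {K L : ChainComplex (ModuleCat.{u} B) ℕ}
  (φ : K ⟶ L)

/-- The modules of the mapping cone of a chain map, in the homological convention. -/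
def coneX (K L : ChainComplex (ModuleCat.{u} B) ℕ) : ℕ → ModuleCat.{u} B
  | 0 => L.X 0
  | k + 1 => ModuleCat.of B (K.X k × L.X (k + 1))

/-- The differential of the mapping cone, `(x, y) ↦ (d x, φ x - d y)`. -/
def coneD : ∀ k, coneX K L (k + 1) ⟶ coneX K L k
  | 0 => ModuleCat.ofHom
      ((φ.f 0).hom ∘ₗ LinearMap.fst B _ _ - (L.d 1 0).hom ∘ₗ LinearMap.snd B _ _)
  | k + 1 => ModuleCat.ofHom (((K.d (k + 1) k).hom ∘ₗ LinearMap.fst B _ _).prod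
      ((φ.f (k + 1)).hom ∘ₗ LinearMap.fst B _ _ - (L.d (k + 2) (k + 1)).hom ∘ₗ LinearMap.snd B _ _))

theorem d_d_apply (K : ChainComplex (ModuleCat.{u} B) ℕ) (i j k : ℕ) (x : K.X i) :
    K.d j k (K.d i j x) = 0 := congrArg (fun f => f.hom x) (K.d_comp_d i j k)

theorem comm_apply (i j : ℕ) (x : K.X i) : φ.f j (K.d i j x) = L.d i j (φ.f i x) :=
  (congrArg (fun f => f.hom x) (φ.comm i j)).symm

theorem coneD_zero_surjective (h : ∀ y : L.X 0, ∃ x z, φ.f 0 x + L.d 1 0 z = y) :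
    Function.Surjective (coneD φ 0) := by
  intro y
  obtain ⟨x, z, h⟩ := h y
  refine ⟨(x, -z), ?_⟩
  change φ.f 0 x - L.d 1 0 (-z) = y
  rw [map_neg, sub_neg_eq_add, h]

theorem coneD_exact (hK : ∀ k, Function.Exact (K.d (k + 2) (k + 1)) (K.d (k + 1) k))
    (hL : ∀ k, Function.Exact (L.d (k + 2) (k + 1)) (L.d (k + 1) k))
    (h : ∀ x y, φ.f 0 x = L.d 1 0 y → ∃ z, K.d 1 0 z = x) (k : ℕ) :
    Function.Exact (coneD φ (k + 1)) (coneD φ k) := by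
  -- a pair `(x, y)` with `φ x = d y` is a boundary as soon as `x` is one
  have key : ∀ k (x : K.X k) (y : L.X (k + 1)), φ.f k x = L.d (k + 1) k y →
      (∃ z, K.d (k + 1) k z = x) → ∃ w, coneD φ (k + 1) w = (x, y) := by
    rintro k _ y hxy ⟨z, rfl⟩
    obtain ⟨w, hw⟩ := (hL k (φ.f (k + 1) z - y)).1 (by
      rw [map_sub, ← comm_apply, hxy, sub_self])
    refine ⟨(z, w), Prod.ext rfl ?_⟩
    change φ.f (k + 1) z - L.d (k + 2) (k + 1) w = y
    rw [hw, sub_sub_cancel]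
  rcases k with _ | k
  · rintro ⟨x, y⟩
    constructor
    · intro hxy
      have hxy : φ.f 0 x - L.d 1 0 y = 0 := hxy
      exact key 0 x y (sub_eq_zero.1 hxy) (h x y (sub_eq_zero.1 hxy))
    · rintro ⟨⟨z, w⟩, hzw⟩
      rw [← hzw]
      change φ.f 0 (K.d 1 0 z) - L.d 1 0 (φ.f 1 z - L.d 2 1 w) = 0
      rw [comm_apply, map_sub, d_d_apply, sub_zero, sub_self]
  · rintro ⟨x, y⟩
    constructor
    · intro hxy
      have h1 : K.d (k + 1) k x = 0 := congrArg Prod.fst hxy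
      have h2 : φ.f (k + 1) x - L.d (k + 2) (k + 1) y = 0 := congrArg Prod.snd hxy
      exact key (k + 1) x y (sub_eq_zero.1 h2) ((hK k x).1 h1)
    · rintro ⟨⟨z, w⟩, hzw⟩
      rw [← hzw]
      refine Prod.ext (d_d_apply K _ _ _ z) ?_
      change φ.f (k + 1) (K.d (k + 2) (k + 1) z) -
        L.d (k + 2) (k + 1) (φ.f (k + 2) z - L.d (k + 3) (k + 2) w) = 0
      rw [comm_apply, map_sub, d_d_apply, sub_zero, sub_self]

/-- Exactness of `Hom(cone φ, Y)` in positive degrees, for a quasi-isomorphism `φ` between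
complexes of modules that are acyclic for `Hom(-, Y)`. -/
theorem exists_cone_factor (hK : ∀ k, Function.Exact (K.d (k + 2) (k + 1)) (K.d (k + 1) k))
    (hL : ∀ k, Function.Exact (L.d (k + 2) (k + 1)) (L.d (k + 1) k))
    (h : ∀ x y, φ.f 0 x = L.d 1 0 y → ∃ z, K.d 1 0 z = x)
    (h0 : ∀ y : L.X 0, ∃ x z, φ.f 0 x + L.d 1 0 z = y)
    (hKY : ∀ k, ExtAcyclic Y (K.X k)) (hLY : ∀ k, ExtAcyclic Y (L.X k)) (k : ℕ)
    (χ₁ : K.X k ⟶ Y) (χ₂ : L.X (k + 1) ⟶ Y)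
    (hχ₁ : ∀ x, χ₁ (K.d (k + 1) k x) + χ₂ (φ.f (k + 1) x) = 0)
    (hχ₂ : ∀ y, χ₂ (L.d (k + 2) (k + 1) y) = 0) :
    ∃ (ψ₁ : K.X (k - 1) ⟶ Y) (ψ₂ : L.X k ⟶ Y),
      (∀ x, χ₁ x = ψ₁ (K.d k (k - 1) x) + ψ₂ (φ.f k x)) ∧
      ∀ y, χ₂ y = -ψ₂ (L.d (k + 1) k y) := by
  have hX : ∀ k, ExtAcyclic Y (coneX K L k) := by
    rintro (_ | k)
    · exact hLY 0
    · exact (hKY k).prod (hLY (k + 1))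
  obtain ⟨ψ, hψ⟩ := exists_factor_of_exact (coneX K L) (coneD φ) hX
    (coneD_zero_surjective φ h0) (coneD_exact φ hK hL h) k
    (ModuleCat.ofHom (χ₁.hom.coprod χ₂.hom)) (by
      ext ⟨x, y⟩
      change χ₁ (K.d (k + 1) k x) + χ₂ (φ.f (k + 1) x - L.d (k + 2) (k + 1) y) = 0
      rw [map_sub, hχ₂, sub_zero, hχ₁])
  have hψ' : ∀ (x : K.X k) (y : L.X (k + 1)), ψ (coneD φ k (x, y)) = χ₁ x + χ₂ y :=
    fun x y => congrArg (fun f => f.hom (x, y)) hψ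
  rcases k with _ | k
  · let ψ' : L.X 0 ⟶ Y := ψ
    refine ⟨0, ψ', fun x => ?_, fun y => ?_⟩
    · have h1 : ψ' (φ.f 0 x - L.d 1 0 0) = χ₁ x + χ₂ 0 := hψ' x 0
      rw [map_zero, sub_zero, map_zero, add_zero] at h1
      rw [← h1]
      exact (zero_add _).symm
    · have h1 : ψ' (φ.f 0 0 - L.d 1 0 y) = χ₁ 0 + χ₂ y := hψ' 0 y
      rw [map_zero, zero_sub, map_zero, zero_add, map_neg] at h1
      exact h1.symm
  · let ψ' : ModuleCat.of B (K.X k × L.X (k + 1)) ⟶ Y := ψ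
    have hadd : ∀ x y, ψ' (x, y) = ψ' (x, 0) + ψ' (0, y) := fun x y => by
      rw [← map_add, Prod.mk_add_mk, add_zero, zero_add]
    refine ⟨ModuleCat.ofHom (ψ'.hom ∘ₗ LinearMap.inl B (K.X k) (L.X (k + 1))),
      ModuleCat.ofHom (ψ'.hom ∘ₗ LinearMap.inr B (K.X k) (L.X (k + 1))), fun x => ?_, fun y => ?_⟩
    · have h1 : ψ' (K.d (k + 1) k x, φ.f (k + 1) x - L.d (k + 2) (k + 1) 0) = χ₁ x + χ₂ 0 :=
        hψ' x 0
      rw [map_zero, sub_zero, map_zero, add_zero, hadd] at h1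
      exact h1.symm
    · have h1 : ψ' (K.d (k + 1) k 0, φ.f (k + 1) 0 - L.d (k + 2) (k + 1) y) = χ₁ 0 + χ₂ y :=
        hψ' 0 y
      rw [map_zero, map_zero, zero_sub, map_zero, zero_add] at h1
      rw [← h1]
      have h2 := map_neg ψ'.hom (0, L.d (k + 2) (k + 1) y)
      rw [Prod.neg_mk, neg_zero] at h2
      exact h2

end Cone

section Characters

variable {R : Type u} [CommRing R] {S : Type u} [Ring S] [Algebra R S] (ε : S →ₐ[R] R)

/-- The group of characters of the trivial right module, as a left module. -/
noncomputable def charDual : ModuleCat.{u} S :=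
  (ModuleCat.restrictScalars (ε : S →+* R)).obj (ModuleCat.of R (CharacterModule (Trivial ε)))

variable {ε} {N : Type u} [AddCommGroup N] [Module S N]

/-- The class of `r ⊗ x` in `1 ⊗_S N`. -/
noncomputable def trivialTmul (r : Trivial ε) (x : N) : Tensor R S (Trivial ε) N :=
  Submodule.Quotient.mk (r ⊗ₜ[ℤ] x)

theorem trivialTmul_add (r : Trivial ε) (x y : N) :
    trivialTmul r (x + y) = trivialTmul r x + trivialTmul r y := by
  rw [trivialTmul, tmul_add]
  rfl

theorem trivialTmul_sub (r : Trivial ε) (x y : N) :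
    trivialTmul r (x - y) = trivialTmul r x - trivialTmul r y := by
  rw [trivialTmul, tmul_sub]
  rfl

theorem add_trivialTmul (r r' : Trivial ε) (x : N) :
    trivialTmul (r + r') x = trivialTmul r x + trivialTmul r' x := by
  rw [trivialTmul, add_tmul]
  rfl

theorem trivialTmul_smul (r : Trivial ε) (s : S) (x : N) :
    trivialTmul r (s • x) = trivialTmul (ε s • r) x :=
  ((Submodule.Quotient.eq (relations R S (Trivial ε) N)).2
    (Submodule.subset_span ⟨r, s, x, rfl⟩)).symm

variable (ε) in
/-- The generator of the trivial module. -/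
def Trivial.one : Trivial ε := (1 : R)

theorem Trivial.smul_one (r : R) : r • Trivial.one ε = (show Trivial ε from r) := mul_one r

/-- The elements `1 ⊗ x` exhaust `1 ⊗_S N`, since `S` contains the ground ring. -/
theorem exists_trivialTmul (z : Tensor R S (Trivial ε) N) :
    ∃ x : N, trivialTmul (Trivial.one ε) x = z := by
  obtain ⟨z, rfl⟩ := Submodule.Quotient.mk_surjective _ z
  induction z with
  | zero => exact ⟨0, by rw [trivialTmul, tmul_zero]⟩
  | add z w hz hw =>
    obtain ⟨x, hx⟩ := hz
    obtain ⟨y, hy⟩ := hw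
    exact ⟨x + y, by rw [trivialTmul_add, hx, hy]; rfl⟩
  | tmul r x =>
    let c : R := r
    refine ⟨algebraMap R S c • x, (trivialTmul_smul _ _ _).trans ?_⟩
    exact congrArg (fun r' : Trivial ε => trivialTmul r' x)
      ((congrArg (· • Trivial.one ε) (ε.commutes c)).trans (Trivial.smul_one c))

/-- The value of a character of the trivial module. -/
def charEval (r : Trivial ε) : charDual ε →+ AddCircle (1 : ℚ) where
  toFun y := (show CharacterModule (Trivial ε) from y) r
  map_zero' := rfl
  map_add' _ _ := rfl

theorem charEval_smul (r : Trivial ε) (s : S) (y : charDual ε) :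
    charEval r (s • y) = charEval (ε s • r) y := rfl

theorem charDual_ext {y z : charDual ε} (h : ∀ r, charEval r y = charEval r z) : y = z :=
  CharacterModule.ext (A := Trivial ε) h

theorem charEval_add (r r' : Trivial ε) (y : charDual ε) :
    charEval (r + r') y = charEval r y + charEval r' y :=
  map_add (show CharacterModule (Trivial ε) from y) r r'

/-- The module map given by a character of `1 ⊗_S N`. -/
noncomputable def charHom (χ : Tensor R S (Trivial ε) N →+ AddCircle (1 : ℚ)) :
    ModuleCat.of S N ⟶ charDual ε :=
  ModuleCat.ofHom (Y := charDual ε)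
    { toFun := fun x => (AddMonoidHom.mk' (fun r => χ (trivialTmul r x)) fun r r' => by
        rw [add_trivialTmul, map_add] : CharacterModule (Trivial ε))
      map_add' := fun x y => charDual_ext fun r => by
        change χ (trivialTmul r (x + y)) = χ (trivialTmul r x) + χ (trivialTmul r y)
        rw [trivialTmul_add, map_add]
      map_smul' := fun s x => charDual_ext fun r => by
        change χ (trivialTmul r (s • x)) = χ (trivialTmul (ε s • r) x)
        rw [trivialTmul_smul] }

/-- A module map to the dual of the trivial module vanishes on the elements that become zero
in `1 ⊗_S N`. -/
theorem charEval_eq_zero (ψ : ModuleCat.of S N ⟶ charDual ε) {r : Trivial ε} {x : N}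
    (h : trivialTmul r x = 0) : charEval r (ψ x) = 0 := by
  let Ψ : Trivial ε ⊗[ℤ] N →+ AddCircle (1 : ℚ) := liftAddHom
    (AddMonoidHom.mk' (fun r => (charEval r).comp (ψ.hom : N →+ charDual ε))
      fun r r' => AddMonoidHom.ext fun x => charEval_add r r' (ψ x))
    fun z r x => by
      change charEval (z • r) (ψ x) = charEval r (ψ (z • x))
      rw [map_zsmul, map_zsmul]
      exact map_zsmul (show CharacterModule (Trivial ε) from ψ x) z r
  have hΨ : ∀ z ∈ relations R S (Trivial ε) N, ∀ c : R, Ψ (c • z) = 0 := by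
    intro z hz
    induction hz using Submodule.span_induction with
    | zero => intro c; rw [smul_zero, map_zero]
    | add z w _ _ hz hw => intro c; rw [smul_add, map_add, hz, hw, add_zero]
    | smul c' z _ hz => intro c; rw [smul_smul, hz]
    | mem z hz =>
      obtain ⟨m, s, x, rfl⟩ := hz
      intro c
      rw [smul_sub, map_sub, sub_eq_zero]
      change charEval (c • ε s • m) (ψ x) = charEval (c • m) (ψ (s • x))
      rw [map_smul, charEval_smul, smul_comm]
  have h0 := hΨ _ ((Submodule.Quotient.mk_eq_zero _).1 h) 1
  rwa [one_smul] at h0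

end Characters

section BaseChange

variable {R : Type u} [CommRing R] {S S' : Type u} [Ring S] [Algebra R S] [Ring S'] [Algebra R S']
  {ε : S →ₐ[R] R} {ε' : S' →ₐ[R] R} {f : S →ₐ[R] S'}

/-- A character of `1 ⊗_{S'} N` as a map of `S`-modules, for a homomorphism `S → S'` of augmented
algebras. -/
noncomputable def restrictCharHom (hf : ε'.comp f = ε) {N : ModuleCat.{u} S'}
    (χ : Tensor R S' (Trivial ε') N →+ AddCircle (1 : ℚ)) :
    (ModuleCat.restrictScalars (f : S →+* S')).obj N ⟶ charDual ε :=
  ModuleCat.ofHom (X := (ModuleCat.restrictScalars (f : S →+* S')).obj N) (Y := charDual ε)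
    { toFun := fun x => charHom χ x
      map_add' := fun x y => map_add (charHom χ).hom x y
      map_smul' := fun s x => by
        subst hf
        exact map_smul (charHom χ).hom (f s) x }

/-- A map of `S`-modules to the dual of the trivial module, defined on an `S'`-module, is a
map of `S'`-modules if `S → S'` is surjective. -/
noncomputable def extendCharHom (hf : ε'.comp f = ε) (hs : Function.Surjective f)
    {N : ModuleCat.{u} S'}
    (ψ : (ModuleCat.restrictScalars (f : S →+* S')).obj N ⟶ charDual ε) :
    N ⟶ charDual ε' :=
  ModuleCat.ofHom (Y := charDual ε')
    { toFun := fun x => ψ x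
      map_add' := fun x y => map_add ψ.hom x y
      map_smul' := fun s x => by
        subst hf
        obtain ⟨s, rfl⟩ := hs s
        exact map_smul ψ.hom s (show (ModuleCat.restrictScalars (f : S →+* S')).obj N from x) }

end BaseChange

end NoncommTor

/-! ### Change of rings for Tor -/

namespace NoncommTor

open CategoryTheory CategoryTheory.Abelian TensorProduct MulOpposite

universe u

/-- Characters separate the elements of an abelian group from its subgroups. -/
theorem mem_of_character {G : Type u} [AddCommGroup G] (H : AddSubgroup G) (g : G)
    (h : ∀ χ : G →+ AddCircle (1 : ℚ), (∀ x ∈ H, χ x = 0) → χ g = 0) : g ∈ H := by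
  rw [← QuotientAddGroup.eq_zero_iff]
  refine CharacterModule.eq_zero_of_character_apply fun χ => ?_
  exact h (AddMonoidHom.comp χ (QuotientAddGroup.mk' H)) fun x hx => 
    (congrArg χ ((QuotientAddGroup.eq_zero_iff x).2 hx)).trans (map_zero χ)

section BaseChange

variable {R : Type u} [CommRing R] {S S' : Type u} [Ring S] [Algebra R S] [Ring S'] [Algebra R S']
  {ε : S →ₐ[R] R} {ε' : S' →ₐ[R] R} {f : S →ₐ[R] S'}

variable (ε ε') in
theorem Trivial.id_semilinear (hf : ε'.comp f = ε) (s : S) (m : Trivial ε) :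
    Trivial.id ε ε' (ε s • m) = ε' (f s) • Trivial.id ε ε' m := by
  rw [map_smul, ← hf]
  rfl

/-- A quasi-isomorphism from a complex of acyclic `S`-modules to a complex of `S'`-modules that are
acyclic over `S` stays a quasi-isomorphism after tensoring with the trivial modules. By duality this
is the exactness of `Hom(cone φ, 1*)`, where `1*` is the character module of the trivial module. -/
theorem isIso_homologyMap_tensorChainMap (hf : ε'.comp f = ε) (hs : Function.Surjective f)
    {K : ChainComplex (ModuleCat.{u} S) ℕ} {L : ChainComplex (ModuleCat.{u} S') ℕ}
    (φ : K ⟶ restrict (f : S →+* S') L)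
    (hK : ∀ k, Function.Exact (K.d (k + 2) (k + 1)) (K.d (k + 1) k))
    (hL : ∀ k, Function.Exact (L.d (k + 2) (k + 1)) (L.d (k + 1) k))
    (h : ∀ (x : K.X 0) (y : L.X 1), toSemilinear (φ.f 0) x = L.d 1 0 y → ∃ z, K.d 1 0 z = x)
    (h0 : ∀ y : L.X 0, ∃ (x : K.X 0) (z : L.X 1), toSemilinear (φ.f 0) x + L.d 1 0 z = y)
    (hKY : ∀ k, ExtAcyclic (charDual ε) (K.X k))
    (hLY : ∀ k, ExtAcyclic (charDual ε)
      ((ModuleCat.restrictScalars (f : S →+* S')).obj (L.X k))) (i : ℕ) :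
    IsIso (HomologicalComplex.homologyMap (tensorChainMap R (f : S →+* S') (Trivial.id ε ε')
      (Trivial.id_semilinear ε ε' hf) φ) i) := by
  let FK := ((tensorFunctor R S (Trivial ε)).mapHomologicalComplex (ComplexShape.down ℕ)).obj K
  let FL := ((tensorFunctor R S' (Trivial ε')).mapHomologicalComplex (ComplexShape.down ℕ)).obj L
  let F : FK ⟶ FL := tensorChainMap R (f : S →+* S') (Trivial.id ε ε')
      (Trivial.id_semilinear ε ε' hf) φ
  -- exactness of the cone of the tensored chain map, in positive degrees
  have key : ∀ (k : ℕ) (z : FK.X k) (w : FL.X (k + 1)), FK.d k (k - 1) z = 0 →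
      F.f k z = FL.d (k + 1) k w → ∃ z' w', FK.d (k + 1) k z' = z ∧
        F.f (k + 1) z' - FL.d (k + 2) (k + 1) w' = w := by
    intro k z w hz hzw
    let D : FK.X (k + 1) × FL.X (k + 2) →+ FK.X k × FL.X (k + 1) :=
      ((FK.d (k + 1) k).hom.toAddMonoidHom.comp (AddMonoidHom.fst _ _)).prod
        ((F.f (k + 1)).hom.toAddMonoidHom.comp (AddMonoidHom.fst _ _) -
          (FL.d (k + 2) (k + 1)).hom.toAddMonoidHom.comp (AddMonoidHom.snd _ _))
    suffices hmem : (z, w) ∈ D.range by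
      obtain ⟨⟨z', w'⟩, h'⟩ := hmem
      exact ⟨z', w', congrArg Prod.fst h', congrArg Prod.snd h'⟩
    -- a character that kills the boundaries is a cocycle of `Hom(cone φ, 1*)`, so a coboundary,
    -- and therefore kills the cycle `(z, w)`
    refine mem_of_character _ _ fun χ hχ => ?_
    let χ₁ : FK.X k →+ AddCircle (1 : ℚ) := χ.comp (AddMonoidHom.inl _ _)
    let χ₂ : FL.X (k + 1) →+ AddCircle (1 : ℚ) := χ.comp (AddMonoidHom.inr _ _)
    have hsplit : ∀ z w, χ (z, w) = χ₁ z + χ₂ w := fun z w => by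
      change χ (z, w) = χ (z, 0) + χ (0, w)
      rw [← map_add, Prod.mk_add_mk, add_zero, zero_add]
    have hD : ∀ z' w', χ₁ (FK.d (k + 1) k z') +
        χ₂ (F.f (k + 1) z' - FL.d (k + 2) (k + 1) w') = 0 := fun z' w' => by
      rw [← hsplit]
      exact hχ _ ⟨(z', w'), rfl⟩
    have hD₁ : ∀ z', χ₁ (FK.d (k + 1) k z') + χ₂ (F.f (k + 1) z') = 0 := fun z' => by
      simpa only [map_zero, sub_zero] using hD z' 0
    have hD₂ : ∀ w', χ₂ (FL.d (k + 2) (k + 1) w') = 0 := fun w' => by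
      simpa only [map_zero, zero_sub, zero_add, map_neg, neg_eq_zero] using hD 0 w'
    obtain ⟨ψ₁, ψ₂, hψ₁, hψ₂⟩ := exists_cone_factor φ hK hL h h0 hKY hLY k
      (charHom (N := K.X k) χ₁) (restrictCharHom hf (N := L.X (k + 1)) χ₂)
      (fun x => charDual_ext fun r => hD₁ (trivialTmul r x))
      (fun y => charDual_ext fun r => hD₂ (trivialTmul (Trivial.id ε ε' r) (show L.X (k + 2) from y)))
    rw [hsplit]
    obtain ⟨x, rfl⟩ := exists_trivialTmul z
    obtain ⟨y, rfl⟩ := exists_trivialTmul w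
    have h1 : charEval (Trivial.one ε) (ψ₁ (K.d k (k - 1) x)) = 0 := charEval_eq_zero ψ₁ hz
    have h2 : charEval (Trivial.one ε') (extendCharHom hf hs ψ₂
        (toSemilinear (φ.f k) x - L.d (k + 1) k y)) = 0 :=
      charEval_eq_zero _ (by rw [trivialTmul_sub, sub_eq_zero]; exact hzw)
    rw [map_sub, map_sub, sub_eq_zero] at h2
    have h3 : charEval (Trivial.one ε) (ψ₂ (φ.f k x)) =
        charEval (Trivial.one ε) (ψ₂ ((restrict (f : S →+* S') L).d (k + 1) k y)) := h2
    have h4 := congrArg (charEval (Trivial.one ε)) (hψ₁ x)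
    have h5 := congrArg (charEval (Trivial.one ε)) (hψ₂ y)
    rw [map_add, h1, zero_add, h3] at h4
    rw [map_neg] at h5
    exact (congrArg₂ (· + ·) h4 h5).trans (add_neg_cancel _)
  refine isIso_homologyMap F i ?_ ?_
  · intro z w hz hzw
    obtain ⟨z', -, h', -⟩ := key i z w hz hzw
    exact ⟨z', h'⟩
  · intro w hw
    rcases i with _ | i
    -- in degree zero, `1 ⊗ -` preserves the surjectivity of the cone's last differential
    · obtain ⟨y, rfl⟩ := exists_trivialTmul w
      obtain ⟨x, z, rfl⟩ := h0 y
      refine ⟨trivialTmul (Trivial.one ε) x, trivialTmul (Trivial.one ε') z, ?_, ?_⟩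
      · rw [FK.shape _ _ (by simp)]
        rfl
      · rw [trivialTmul_add]
        rfl
    · obtain ⟨z, w', h1, h2⟩ := key i 0 w (map_zero _) (by rw [map_zero]; exact hw.symm)
      exact ⟨z, -w', h1, by rw [map_neg, ← sub_eq_add_neg, h2]⟩

theorem exact_projectiveResolution {N : ModuleCat.{u} S} (P : ProjectiveResolution N) (k : ℕ) :
    Function.Exact (P.complex.d (k + 2) (k + 1)) (P.complex.d (k + 1) k) := fun x =>
  ⟨(ShortComplex.moduleCat_exact_iff _).1 (P.exact_succ k) x, by
    rintro ⟨y, rfl⟩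
    exact d_d_apply P.complex _ _ _ y⟩

/-- A surjective homomorphism `S → S'` of augmented algebras induces isomorphisms on
`Tor(1, 1)` if the projective `S'`-modules are acyclic over `S`: then a projective resolution of
the trivial module over `S'` computes `Tor` over `S` as well. -/
theorem isIso_trivialMap (hf : ε'.comp f = ε) (hs : Function.Surjective f)
    (hac : ∀ (N : ModuleCat.{u} S') [Projective N], ExtAcyclic (charDual ε)
      ((ModuleCat.restrictScalars (f : S →+* S')).obj N)) (i : ℕ) :
    IsIso (Tor.trivialMap ε ε' f hf i) := by
  let h : Trivial ε →ₛₗ[(f : S →+* S')] Trivial ε' :=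
    { toFun := Trivial.id ε ε'
      map_add' := map_add (Trivial.id ε ε')
      map_smul' := Trivial.id_semilinear ε ε' hf }
  let P := projectiveResolution (ModuleCat.of S (Trivial ε))
  let Q := projectiveResolution (ModuleCat.of S' (Trivial ε'))
  let φ := (exists_lift (f : S →+* S') (ofSemilinear h) P Q).choose
  have hφ : ∀ x, aug Q (toSemilinear (φ.f 0) x) = h (aug P x) := fun x => congrArg (fun ψ => ψ.hom x)
    (exists_lift (f : S →+* S') (ofSemilinear h) P Q).choose_spec
  have hP : ∀ x, aug P x = 0 → ∃ z, P.complex.d 1 0 z = x :=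
    (ShortComplex.moduleCat_exact_iff _).1 (exact_aug P)
  have hQ : ∀ x, aug Q x = 0 → ∃ z, Q.complex.d 1 0 z = x :=
    (ShortComplex.moduleCat_exact_iff _).1 (exact_aug Q)
  have hQ' : ∀ y, aug Q (Q.complex.d 1 0 y) = 0 := fun y => congrArg (fun ψ => ψ.hom y) (d_aug Q)
  have := isIso_homologyMap_tensorChainMap hf hs φ (exact_projectiveResolution P)
    (exact_projectiveResolution Q)
    (fun x y hxy => hP x (by
      have h1 := hφ x
      rw [hxy, hQ'] at h1
      exact h1.symm))
    (fun y => by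
      obtain ⟨x, hx⟩ := (ModuleCat.epi_iff_surjective (aug P)).1 inferInstance (aug Q y)
      obtain ⟨z, hz⟩ := hQ (y - toSemilinear (φ.f 0) x) (by
        rw [map_sub, hφ, hx]
        exact sub_self _)
      exact ⟨x, z, by rw [hz, add_sub_cancel]⟩)
    (fun k => ExtAcyclic.of_projective) (fun k => hac (Q.complex.X k)) i
  exact IsIso.comp_isIso' (Iso.isIso_hom _) (IsIso.comp_isIso' this (Iso.isIso_inv _))

end BaseChange

end NoncommTor

/-! ### Quotients by projective idempotent ideals -/

namespace NoncommTor

open CategoryTheory CategoryTheory.Abelian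

universe u

section Step

variable {R : Type u} [CommRing R] {S S' S'' : Type u} [Ring S] [Algebra R S] [Ring S']
  [Algebra R S'] [Ring S''] [Algebra R S'']

/-- The kernel of `g` is generated, as a left ideal, by finitely many elements `e i` of the kernel,
with coefficients that are linear functions with values in the kernel. Thus the kernel is an
idempotent ideal that is projective as a left module. -/
def HasDualBasis (g : S' →ₐ[R] S'') : Prop :=
  ∃ (ι : Type) (_ : Fintype ι) (π : ι → RingHom.ker g →ₗ[S'] RingHom.ker g) (e : ι → RingHom.ker g),
    ∀ x, x = ∑ i, (π i x : S') • e i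

theorem HasDualBasis.projective {g : S' →ₐ[R] S''} (hg : HasDualBasis g) :
    Module.Projective S' (RingHom.ker g) := by
  obtain ⟨ι, _, π, e, h⟩ := hg
  refine Module.Projective.of_split
    (LinearMap.pi fun i => (RingHom.ker g).subtype ∘ₗ π i)
    (Fintype.linearCombination S' e) (LinearMap.ext fun x => ?_)
  exact (h x).symm

theorem exists_retract_free (N : ModuleCat.{u} S) [Projective N] :
    Nonempty (Retract N (ModuleCat.of S (N →₀ S))) := by
  let p : ModuleCat.of S (N →₀ S) ⟶ N := ModuleCat.ofHom (Finsupp.linearCombination S id)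
  have : Epi p := (ModuleCat.epi_iff_surjective _).2 (Finsupp.linearCombination_id_surjective S N)
  exact ⟨⟨Projective.factorThru (𝟙 N) p, p, Projective.factorThru_comp _ _⟩⟩

variable {ε : S →ₐ[R] R} {ε' : S' →ₐ[R] R} {ε'' : S'' →ₐ[R] R} {f : S →ₐ[R] S'} {g : S' →ₐ[R] S''}

/-- An `S`-linear map from copies of the kernel of `g` to the dual of the trivial module vanishes:
the kernel is idempotent and acts as zero on the trivial module. -/
theorem HasDualBasis.hom_eq_zero (hg : HasDualBasis g) (hf' : ε''.comp (g.comp f) = ε)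
    (hs : Function.Surjective f) (X : Type u)
    (φ : (ModuleCat.restrictScalars (f : S →+* S')).obj (ModuleCat.of S' (X →₀ RingHom.ker g)) ⟶
      charDual ε) : φ = 0 := by
  obtain ⟨ι, _, π, e, h⟩ := hg
  let φ' : (X →₀ RingHom.ker g) →+ charDual ε := φ.hom.toAddMonoidHom
  have hφ' : ∀ (s : S) k, φ' (f s • k) = s • φ' k := fun s k =>
    map_smul φ.hom s (show (ModuleCat.restrictScalars (f : S →+* S')).obj
      (ModuleCat.of S' (X →₀ RingHom.ker g)) from k)
  suffices h0 : φ' = 0 by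
    ext k
    exact DFunLike.congr_fun h0 k
  refine Finsupp.addHom_ext fun x j => ?_
  have hj : Finsupp.single x j = ∑ i, (π i j : S') • Finsupp.single x (e i) := by
    conv_lhs => rw [h j]
    simp only [Finsupp.single_finsetSum, Finsupp.smul_single]
  rw [hj, map_sum]
  refine Finset.sum_eq_zero fun i _ => ?_
  obtain ⟨s, hs⟩ := hs (π i j : S')
  rw [← hs, hφ']
  refine charDual_ext fun r => ?_
  have hεs : ε s = 0 := by
    have h1 : g (f s) = 0 := by rw [hs]; exact (π i j).2
    rw [← hf', AlgHom.comp_apply, AlgHom.comp_apply, h1, map_zero]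
  rw [charEval_smul, hεs, zero_smul, map_zero]
  exact map_zero (show CharacterModule (Trivial ε) from φ' _)

/-- Acyclicity over `S` passes from projective `S'`-modules to projective `S''`-modules, for a
surjection `S' → S''` whose kernel is projective and idempotent. -/
theorem extAcyclic_comp (hg : HasDualBasis g) (hf' : ε''.comp (g.comp f) = ε)
    (hs : Function.Surjective f) (hsg : Function.Surjective g)
    (hac : ∀ (N : ModuleCat.{u} S') [Projective N], ExtAcyclic (charDual ε)
      ((ModuleCat.restrictScalars (f : S →+* S')).obj N))
    (N : ModuleCat.{u} S'') [Projective N] : ExtAcyclic (charDual ε)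
      ((ModuleCat.restrictScalars (g.comp f : S →+* S'')).obj N) := by
  obtain ⟨r⟩ := exists_retract_free N
  refine ExtAcyclic.of_retract ?_ (r.map (ModuleCat.restrictScalars (g.comp f : S →+* S'')))
  generalize (N : Type u) = X
  let U₁ := (ModuleCat.restrictScalars (f : S →+* S')).obj (ModuleCat.of S' (X →₀ RingHom.ker g))
  let U₂ := (ModuleCat.restrictScalars (f : S →+* S')).obj (ModuleCat.of S' (X →₀ S'))
  let U₃ := (ModuleCat.restrictScalars (g.comp f : S →+* S'')).obj (ModuleCat.of S'' (X →₀ S''))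
  let i : U₁ ⟶ U₂ := (ModuleCat.restrictScalars (f : S →+* S')).map
    (ModuleCat.ofHom (Finsupp.mapRange.linearMap (RingHom.ker g).subtype))
  let p : U₂ ⟶ U₃ := ModuleCat.ofHom (X := U₂) (Y := U₃)
    { toFun := fun k => Finsupp.mapRange g (map_zero g) k
      map_add' := fun k k' => Finsupp.mapRange_add (map_add g) k k'
      map_smul' := fun s k => Finsupp.ext fun x => map_mul g (f s) ((show X →₀ S' from k) x) }
  let T : ShortComplex (ModuleCat.{u} S) := ShortComplex.mk i p (by
    ext k
    exact Finsupp.ext fun x => ((show X →₀ RingHom.ker g from k) x).2)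
  have hT : T.ShortExact :=
    { exact := (ShortComplex.moduleCat_exact_iff _).2 fun (k : X →₀ S') hk => by
        have hk' : ∀ x, g (k x) = 0 := fun x => DFunLike.congr_fun (show _ = (0 : X →₀ S'') from hk) x
        exact ⟨(⟨k.support, fun x => ⟨k x, hk' x⟩, fun x => by simp [Subtype.ext_iff]⟩ :
          X →₀ RingHom.ker g), Finsupp.ext fun x => rfl⟩
      mono_f := (ModuleCat.mono_iff_injective _).2
        (Finsupp.mapRange_injective _ rfl Subtype.val_injective)
      epi_g := (ModuleCat.epi_iff_surjective _).2 (Finsupp.mapRange_surjective g (map_zero g) hsg) }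
  classical
  have := hg.projective
  have : Projective (ModuleCat.of S' (X →₀ RingHom.ker g)) :=
    (IsProjective.iff_projective _).1 (Module.Projective.of_equiv' (finsuppLequivDFinsupp S').symm)
  have : Projective (ModuleCat.of S' (X →₀ S')) :=
    (IsProjective.iff_projective _).1 inferInstance
  exact ExtAcyclic.cokernel hT (hac (ModuleCat.of S' (X →₀ RingHom.ker g)))
    (hac (ModuleCat.of S' (X →₀ S'))) (hg.hom_eq_zero hf' hs X)

end Step

end NoncommTor

/-! ### Products of diagrams and link states -/

namespace Brauer

universe u

section Combinatorics

variable {n t : ℕ}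

theorem Diagram.eq_of_le {d e : Diagram n} (h : d.1 ≤ e.1) : d = e := by
  refine Subtype.ext (le_antisymm h fun x y hxy => ?_)
  obtain ⟨z, hzx, hz⟩ := d.exists_rel x
  by_cases hyx : y = x
  · rw [hyx]
  · rwa [e.eq_of_rel hxy (h hz) hyx hzx]

/-- If a product has as many left-to-right connections as its right factor, then it has the same
right-hand side as this factor. -/
theorem Diagram.comap_inr_mul {d e : Diagram n} (h : (d.mul e).through = e.through) :
    (d.mul e).1.comap Sum.inr = e.1.comap Sum.inr := by
  have hsub : {j | ∃ i, (d.mul e).1 (Sum.inl i) (Sum.inr j)} ⊆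
      {j | ∃ i, e.1 (Sum.inl i) (Sum.inr j)} := by
    rintro j ⟨i, hij⟩
    obtain ⟨y | y, hne, hy⟩ := e.exists_rel (Sum.inr j)
    · exact ⟨y, e.1.symm' hy⟩
    · exact (Sum.inr_ne_inl ((d.mul e).eq_of_rel (d.mul_inr_inr e hy)
        ((d.mul e).1.symm' hij) hne Sum.inl_ne_inr)).elim
  rw [through_eq_right, through_eq_right] at h
  have heq := Set.eq_of_subset_of_ncard_le hsub h.ge
  refine Setoid.ext fun j k => ⟨fun hjk => ?_, fun hjk => d.mul_inr_inr e hjk⟩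
  by_cases hkj : k = j
  · rw [hkj]
  have hne : (Sum.inr k : Fin n ⊕ Fin n) ≠ Sum.inr j := fun h => hkj (Sum.inr_injective h)
  obtain ⟨y | y, hy, hjy⟩ := e.exists_rel (Sum.inr j)
  · obtain ⟨i, hi⟩ : j ∈ {j | ∃ i, (d.mul e).1 (Sum.inl i) (Sum.inr j)} :=
      heq ▸ ⟨y, e.1.symm' hjy⟩
    exact (Sum.inr_ne_inl ((d.mul e).eq_of_rel hjk ((d.mul e).1.symm' hi) hne Sum.inl_ne_inr)).elim
  · obtain rfl : k = y :=
      Sum.inr_injective ((d.mul e).eq_of_rel hjk (d.mul_inr_inr e hjy) hne hy)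
    exact hjy

namespace LinkState

variable {q p : LinkState n t}

theorem comap_inr_diagram (p : LinkState n t) (σ : Equiv.Perm (Fin t)) (q : LinkState n t) :
    (diagram p σ q).1.comap Sum.inr = q.rel := rfl

theorem rel_injective : Function.Injective (rel : LinkState n t → Setoid (Fin n)) := by
  rintro ⟨r, _, _⟩ ⟨r', _, _⟩ (rfl : r = r')
  rfl

instance : Finite (LinkState n t) :=
  Finite.of_injective (fun p x y => p.rel x y) fun _ _ h =>
    rel_injective (Setoid.ext fun x y => (congrFun (congrFun h x) y).to_iff)

/-- If the pair set has the maximal cardinality, then the components of the pair graph match the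
defects of `p` with those of `q`. -/
theorem exists_matching (h : (pairSet q p).ncard = t) : ∃ π : Equiv.Perm (Fin t), ∀ i,
    (pairGraph q p).Reachable (q.defect (π i)) (p.defect i) := by
  have hinj : ∀ c : Fin t → (pairGraph q p).ConnectedComponent, pairSet q p ⊆ Set.range c →
      Function.Injective c ∧ pairSet q p = Set.range c := by
    intro c hc
    have h1 : (Set.range c).ncard ≤ t := by
      rw [← Set.image_univ]
      exact (Set.ncard_image_le).trans (by simp [Set.ncard_univ])
    have h2 := Set.eq_of_subset_of_ncard_le hc (by rw [h]; exact h1)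
    refine ⟨Set.injOn_univ.1 (Set.injOn_of_ncard_image_eq ?_), h2⟩
    rw [Set.image_univ, ← h2, h]
    simp [Set.ncard_univ]
  obtain ⟨-, hq⟩ := hinj _ Set.inter_subset_left
  obtain ⟨hp, hp'⟩ := hinj _ Set.inter_subset_right
  have hex : ∀ i, ∃ j, (pairGraph q p).connectedComponentMk (q.defect j) =
      (pairGraph q p).connectedComponentMk (p.defect i) := fun i => by
    have : (pairGraph q p).connectedComponentMk (p.defect i) ∈ pairSet q p := hp' ▸ ⟨i, rfl⟩
    rwa [hq] at this
  choose π hπ using hex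
  have hπi : Function.Injective π := fun i j hij => hp (by
    change (pairGraph q p).connectedComponentMk _ = (pairGraph q p).connectedComponentMk _
    rw [← hπ, ← hπ, hij])
  exact ⟨Equiv.ofBijective π (Finite.injective_iff_bijective.1 hπi),
    fun i => SimpleGraph.ConnectedComponent.exact (hπ i)⟩

theorem glue_of_reachable (x y : LinkState n t) (σ τ : Equiv.Perm (Fin t)) {i j : Fin n}
    (h : (pairGraph q p).Reachable i j) :
    glue (diagram x σ q).1 (diagram p τ y).1 (Sum.inr (Sum.inl i)) (Sum.inr (Sum.inl j)) := by
  rw [SimpleGraph.reachable_iff_reflTransGen] at h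
  induction h with
  | refl => exact Setoid.refl' _ _
  | tail _ h ih =>
    refine Setoid.trans' _ ih ?_
    rcases h.2 with h | h
    · exact (le_sup_left : _ ≤ glue (diagram x σ q).1 (diagram p τ y).1)
        (Setoid.le_comap_map (show (diagram x σ q).1 (Sum.inr _) (Sum.inr _) from h))
    · exact (le_sup_right : _ ≤ glue (diagram x σ q).1 (diagram p τ y).1)
        (Setoid.le_comap_map (show (diagram p τ y).1 (Sum.inl _) (Sum.inl _) from h))

theorem glue_left (x y : LinkState n t) (σ τ : Equiv.Perm (Fin t)) (i : Fin t) :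
    glue (diagram x σ q).1 (diagram p τ y).1 (Sum.inl (x.defect (σ i)))
      (Sum.inr (Sum.inl (q.defect i))) :=
  (le_sup_left : _ ≤ glue (diagram x σ q).1 (diagram p τ y).1)
    (Setoid.le_comap_map (show (diagram x σ q).1 (Sum.inl _) (Sum.inr _) from ⟨i, rfl, rfl⟩))

theorem glue_right (x y : LinkState n t) (σ τ : Equiv.Perm (Fin t)) (i : Fin t) :
    glue (diagram x σ q).1 (diagram p τ y).1 (Sum.inr (Sum.inl (p.defect (τ i))))
      (Sum.inr (Sum.inr (y.defect i))) :=
  (le_sup_right : _ ≤ glue (diagram x σ q).1 (diagram p τ y).1)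
    (Setoid.le_comap_map (show (diagram p τ y).1 (Sum.inl _) (Sum.inr _) from ⟨i, rfl, rfl⟩))

theorem diagram_mul_diagram {π : Equiv.Perm (Fin t)}
    (hπ : ∀ i, (pairGraph q p).Reachable (q.defect (π i)) (p.defect i)) (x y : LinkState n t)
    (σ τ : Equiv.Perm (Fin t)) :
    (diagram x σ q).mul (diagram p τ y) = diagram x (σ * π * τ) y := by
  symm
  have key : ∀ i, ((diagram x σ q).mul (diagram p τ y)).1
      (Sum.inl (x.defect ((σ * π * τ) i))) (Sum.inr (y.defect i)) := fun i =>
    Setoid.trans' (glue (diagram x σ q).1 (diagram p τ y).1) (glue_left x y σ τ (π (τ i)))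
      (Setoid.trans' _ (glue_of_reachable x y σ τ (hπ (τ i))) (glue_right x y σ τ i))
  refine Diagram.eq_of_le ?_
  rintro (a | a) (b | b) h
  · exact Diagram.mul_inl_inl _ _ (show (diagram x σ q).1 (Sum.inl _) (Sum.inl _) from h)
  · obtain ⟨i, rfl, rfl⟩ := h
    exact key i
  · obtain ⟨i, rfl, rfl⟩ := h
    exact Setoid.symm' _ (key i)
  · exact Diagram.mul_inr_inr _ _ (show (diagram p τ y).1 (Sum.inr _) (Sum.inr _) from h)

/-- Either `δ` itself is invertible, or every component of the pair graph contains a defect, in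
which case no loops occur. -/
theorem isUnit_pow_loops {R : Type u} [CommRing R] {δ : R}
    (h : IsUnit (δ ^ (pairLoops q p).ncard)) (x y : LinkState n t) (σ τ : Equiv.Perm (Fin t)) :
    IsUnit (δ ^ (diagram x σ q).loops (diagram p τ y)) := by
  rcases eq_or_ne (pairLoops q p).ncard 0 with h0 | h0
  · have h1 : (diagram x σ q).loops (diagram p τ y) = 0 := by
      refine loops_eq_zero _ _ fun j => ?_
      have hj : (pairGraph q p).connectedComponentMk j ∉ pairLoops q p := by
        rw [(Set.ncard_eq_zero (Set.toFinite _)).1 h0]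
        exact Set.notMem_empty _
      rcases not_not.1 hj with ⟨i, hi⟩ | ⟨i, hi⟩
      · exact ⟨Sum.inl (x.defect (σ i)), Setoid.trans' _ (glue_left x y σ τ i)
          (glue_of_reachable x y σ τ (SimpleGraph.ConnectedComponent.exact hi))⟩
      · refine ⟨Sum.inr (y.defect (τ.symm i)), Setoid.trans' _
          (Setoid.symm' _ (glue_right x y σ τ (τ.symm i))) ?_⟩
        rw [Equiv.apply_symm_apply]
        exact glue_of_reachable x y σ τ (SimpleGraph.ConnectedComponent.exact hi)
    rw [h1, pow_zero]
    exact isUnit_one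
  · exact ((isUnit_pow_iff h0).1 h).pow _

end LinkState

end Combinatorics

section Restriction

variable {R : Type u} [CommRing R] {n : ℕ} {δ : R} {A : Subalgebra R (BrauerAlgebra R n δ)}
  {M' : ∀ t, Set (LinkState n t)} {G' : ∀ t, Subgroup (Equiv.Perm (Fin t))}

theorem ObtainedByRestriction.of_diagram_mem (hA : ObtainedByRestriction A M' G') {t : ℕ}
    {p q : LinkState n t} (hp : p ∈ M' t) (hq : q ∈ M' t) {σ : Equiv.Perm (Fin t)}
    (hσ : σ ∈ G' t) : BrauerAlgebra.of R δ (LinkState.diagram p σ q) ∈ A := by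
  obtain ⟨b, hb⟩ := hA
  rw [← hb t ⟨p, hp⟩ ⟨σ, hσ⟩ ⟨q, hq⟩]
  exact (b _).2

theorem of_mem_ambientLE {a : ℤ} {d : Diagram n} (h : (d.through : ℤ) ≤ a) :
    BrauerAlgebra.of R δ d ∈ ambientLE R n δ a := Submodule.subset_span ⟨d, h, rfl⟩

/-- Under Hypothesis (†) every `q ∈ M' t` has an element `e` of `A`, a multiple of a diagram with
`t` left-to-right connections, that acts from the right as the identity on all diagrams with
right-hand side `q`. -/
theorem exists_right_identity (hA : ObtainedByRestriction A M' G') {t : ℕ}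
    (hdag : HypothesisDagger δ M' t) {q : LinkState n t} (hq : q ∈ M' t) :
    ∃ e ∈ A, e ∈ ambientLE R n δ t ∧ ∀ (x : LinkState n t) (σ : Equiv.Perm (Fin t)),
      BrauerAlgebra.of R δ (LinkState.diagram x σ q) * e =
        BrauerAlgebra.of R δ (LinkState.diagram x σ q) := by
  obtain ⟨p, hp, hcard, hunit⟩ := hdag q hq
  obtain ⟨π, hπ⟩ := LinkState.exists_matching hcard
  -- the diagrams `C_{p,q}^σ` with `σ` a power of `π` belong to `A`
  have hpow : ∀ k : ℕ, BrauerAlgebra.of R δ (LinkState.diagram p (π ^ k) q) ∈ A := by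
    intro k
    induction k with
    | zero => exact hA.of_diagram_mem hp hq (one_mem _)
    | succ k ih =>
      have h1 := A.mul_mem ih (hA.of_diagram_mem (σ := 1) hp hq (one_mem _))
      rw [BrauerAlgebra.of_mul_of, LinkState.diagram_mul_diagram hπ, mul_one, ← pow_succ] at h1
      obtain ⟨u, hu⟩ := LinkState.isUnit_pow_loops hunit p q (π ^ k) 1
      rw [← hu] at h1
      have h2 := A.smul_mem h1 (↑u⁻¹ : R)
      rwa [smul_smul, Units.inv_mul, one_smul] at h2
  obtain ⟨k, hk : π ^ k = π⁻¹⟩ : π⁻¹ ∈ Submonoid.powers π :=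
    mem_powers_iff_mem_zpowers.2 (Subgroup.inv_mem _ (Subgroup.mem_zpowers π))
  let E : Diagram n := LinkState.diagram p π⁻¹ q
  have hE : BrauerAlgebra.of R δ E ∈ A := by
    have h1 := hpow k
    rwa [hk] at h1
  obtain ⟨u, hu⟩ := LinkState.isUnit_pow_loops hunit p q π⁻¹ π⁻¹
  have hmul : ∀ x σ, (LinkState.diagram x σ q).mul E = LinkState.diagram x σ q := fun x σ => by
    rw [LinkState.diagram_mul_diagram hπ, mul_inv_cancel_right]
  -- the number of loops is independent of the left factor, as `E` is idempotent
  have hloops : ∀ x σ, (LinkState.diagram x σ q).loops E = E.loops E := fun x σ => by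
    have h1 := loops_assoc (LinkState.diagram x σ q).1 E.1 E.1
    have h2 : concat (LinkState.diagram x σ q).1 E.1 = (LinkState.diagram x σ q).1 :=
      congrArg Subtype.val (hmul x σ)
    have h3 : concat E.1 E.1 = E.1 := congrArg Subtype.val (hmul p π⁻¹)
    rw [h2, h3] at h1
    exact Nat.add_right_cancel h1
  refine ⟨(↑u⁻¹ : R) • BrauerAlgebra.of R δ E, A.smul_mem hE _,
    Submodule.smul_mem _ _ (of_mem_ambientLE ?_), fun x σ => ?_⟩
  · rw [LinkState.through_diagram]
  · rw [mul_smul_comm, BrauerAlgebra.of_mul_of, hmul, hloops]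
    change (↑u⁻¹ : R) • δ ^ (LinkState.diagram p π⁻¹ q).loops (LinkState.diagram p π⁻¹ q) • _ = _
    rw [← hu, smul_smul, Units.inv_mul, one_smul]

end Restriction

end Brauer

/-! ### Components of diagrams by their right-hand sides -/

namespace Brauer

universe u

section Projection

variable {R : Type u} [CommRing R] {n : ℕ} {δ : R}

open Classical in
/-- The linear projection of the Brauer algebra to the span of the diagrams that have `t`
left-to-right connections and whose right-hand side is the partition `s`. -/
noncomputable def rightProj (R : Type u) [CommRing R] (δ : R) (t : ℕ) (s : Setoid (Fin n)) :
    BrauerAlgebra R n δ →ₗ[R] BrauerAlgebra R n δ :=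
  (BrauerAlgebra.basis R n δ).constr R fun d =>
    if d.through = t ∧ d.1.comap Sum.inr = s then BrauerAlgebra.of R δ d else 0

open Classical in
theorem rightProj_of (t : ℕ) (s : Setoid (Fin n)) (d : Diagram n) :
    rightProj R δ t s (BrauerAlgebra.of R δ d) =
      if d.through = t ∧ d.1.comap Sum.inr = s then BrauerAlgebra.of R δ d else 0 := by
  rw [rightProj, BrauerAlgebra.of, Module.Basis.constr_basis]
  rfl

open Classical in
theorem rightProj_diagram (t : ℕ) (s : Setoid (Fin n)) {t' : ℕ} (p : LinkState n t')
    (σ : Equiv.Perm (Fin t')) (q : LinkState n t') :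
    rightProj R δ t s (BrauerAlgebra.of R δ (LinkState.diagram p σ q)) =
      if t' = t ∧ q.rel = s then BrauerAlgebra.of R δ (LinkState.diagram p σ q) else 0 := by
  rw [rightProj_of, LinkState.through_diagram, LinkState.comap_inr_diagram]

theorem rightProj_eq_zero {t : ℕ} (s : Setoid (Fin n)) {a : ℤ} (ha : a < t)
    {x : BrauerAlgebra R n δ} (hx : x ∈ ambientLE R n δ a) : rightProj R δ t s x = 0 := by
  have : ambientLE R n δ a ≤ LinearMap.ker (rightProj R δ t s) := by
    refine Submodule.span_le.2 ?_
    rintro _ ⟨d, hd, rfl⟩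
    have hd : (d.through : ℤ) ≤ a := hd
    rw [SetLike.mem_coe, LinearMap.mem_ker, rightProj_of, if_neg]
    rintro ⟨h, -⟩
    omega
  exact this hx

/-- Modulo diagrams with fewer left-to-right connections, left multiplication does not change the
right-hand side of a diagram. -/
theorem rightProj_mul (t : ℕ) (s : Setoid (Fin n)) (a x : BrauerAlgebra R n δ)
    (hx : x ∈ ambientLE R n δ t) :
    rightProj R δ t s (a * x) - a * rightProj R δ t s x ∈ ambientLE R n δ (t - 1) := by
  unfold ambientLE at hx
  induction hx using Submodule.span_induction with
  | zero => rw [mul_zero, map_zero, mul_zero, sub_zero]; exact zero_mem _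
  | add y z _ _ hy hz =>
    rw [mul_add, map_add, map_add, mul_add, add_sub_add_comm]
    exact add_mem hy hz
  | smul r y _ hy =>
    rw [mul_smul_comm, map_smul, map_smul, mul_smul_comm, ← smul_sub]
    exact Submodule.smul_mem _ _ hy
  | mem y hy =>
    obtain ⟨e, he, rfl⟩ := hy
    have he : (e.through : ℤ) ≤ t := he
    induction a using BrauerAlgebra.induction with
    | hadd a b ha hb =>
      rw [add_mul, map_add, add_mul, add_sub_add_comm]
      exact add_mem ha hb
    | hsmul r a ha =>
      rw [smul_mul_assoc, map_smul, smul_mul_assoc, ← smul_sub]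
      exact Submodule.smul_mem _ _ ha
    | hof d =>
      have hle := Diagram.through_mul_le_right d e
      rw [BrauerAlgebra.of_mul_of, map_smul, rightProj_of, rightProj_of]
      by_cases ht : (d.mul e).through = t
      · have heq : (d.mul e).through = e.through := by omega
        rw [Diagram.comap_inr_mul heq, heq]
        split_ifs
        · rw [BrauerAlgebra.of_mul_of, sub_self]
          exact zero_mem _
        · rw [smul_zero, mul_zero, sub_zero]
          exact zero_mem _
      · rw [if_neg (fun h => ht h.1), smul_zero, zero_sub]
        refine neg_mem ?_
        split_ifs
        · rw [BrauerAlgebra.of_mul_of]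
          exact Submodule.smul_mem _ _ (of_mem_ambientLE (by omega))
        · rw [mul_zero]
          exact zero_mem _

variable {A : Subalgebra R (BrauerAlgebra R n δ)}
  {M' : ∀ t, Set (LinkState n t)} {G' : ∀ t, Subgroup (Equiv.Perm (Fin t))}

theorem rightProj_mem (hA : ObtainedByRestriction A M' G') (t : ℕ) (s : Setoid (Fin n)) {a : ℤ}
    {x : A} (hx : x ∈ spanLE A M' G' a) :
    rightProj R δ t s (x : BrauerAlgebra R n δ) ∈ A ∧
      rightProj R δ t s (x : BrauerAlgebra R n δ) ∈ ambientLE R n δ a := by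
  have : spanLE A M' G' a ≤ (Subalgebra.toSubmodule A ⊓ ambientLE R n δ a).comap
      (rightProj R δ t s ∘ₗ A.val.toLinearMap) := by
    refine Submodule.span_le.2 ?_
    rintro y ⟨t', ht', p, hp, σ, hσ, q, hq, hy⟩
    change rightProj R δ t s (y : BrauerAlgebra R n δ) ∈
      Subalgebra.toSubmodule A ⊓ ambientLE R n δ a
    rw [hy, rightProj_of]
    split_ifs
    · exact ⟨hA.of_diagram_mem hp hq hσ, of_mem_ambientLE (by rwa [LinkState.through_diagram])⟩
    · exact zero_mem _
  exact this hx

/-- An element of `I_{≤ t}` is the sum of its components for the right-hand sides in `M' t`,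
modulo `I_{≤ t - 1}`. -/
theorem sub_sum_rightProj_mem (t : ℕ) [Fintype (M' t)] {x : A} (hx : x ∈ spanLE A M' G' t) :
    (x : BrauerAlgebra R n δ) - ∑ q : M' t, rightProj R δ t q.1.rel x ∈
      ambientLE R n δ (t - 1) := by
  have : spanLE A M' G' t ≤ (ambientLE R n δ (t - 1)).comap
      ((LinearMap.id - ∑ q : M' t, rightProj R δ t q.1.rel) ∘ₗ A.val.toLinearMap) := by
    refine Submodule.span_le.2 ?_
    rintro y ⟨t', ht', p, hp, σ, hσ, q, hq, hy⟩
    change ((LinearMap.id : BrauerAlgebra R n δ →ₗ[R] _) - ∑ q : M' t, rightProj R δ t q.1.rel)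
      (y : BrauerAlgebra R n δ) ∈ ambientLE R n δ (t - 1)
    rw [hy, LinearMap.sub_apply, LinearMap.sum_apply]
    simp only [rightProj_diagram]
    rcases eq_or_ne t' t with rfl | hne
    · rw [Finset.sum_eq_single ⟨q, hq⟩, if_pos ⟨rfl, rfl⟩, LinearMap.id_apply, sub_self]
      · exact zero_mem _
      · intro q' _ hne
        exact if_neg fun h => hne (Subtype.ext (LinkState.rel_injective h.2.symm))
      · exact fun h => (h (Finset.mem_univ _)).elim
    · rw [Finset.sum_eq_zero fun q' _ => if_neg fun h => hne h.1, sub_zero]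
      refine of_mem_ambientLE ?_
      rw [LinkState.through_diagram]
      omega
  have h := this hx
  rw [Submodule.mem_comap, LinearMap.comp_apply, LinearMap.sub_apply, LinearMap.sum_apply] at h
  exact h

theorem rightProj_mul_eq {t : ℕ} {q : LinkState n t} {e : BrauerAlgebra R n δ}
    (he : ∀ (x : LinkState n t) (σ : Equiv.Perm (Fin t)),
      BrauerAlgebra.of R δ (LinkState.diagram x σ q) * e =
        BrauerAlgebra.of R δ (LinkState.diagram x σ q)) {x : A} (hx : x ∈ spanLE A M' G' t) :
    rightProj R δ t q.rel (x : BrauerAlgebra R n δ) * e =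
      rightProj R δ t q.rel (x : BrauerAlgebra R n δ) := by
  have : spanLE A M' G' t ≤ LinearMap.eqLocus
      (LinearMap.mulRight R e ∘ₗ rightProj R δ t q.rel ∘ₗ A.val.toLinearMap)
      (rightProj R δ t q.rel ∘ₗ A.val.toLinearMap) := by
    refine Submodule.span_le.2 ?_
    rintro y ⟨t', ht', p, hp, σ, hσ, q', hq, hy⟩
    change rightProj R δ t q.rel (y : BrauerAlgebra R n δ) * e =
      rightProj R δ t q.rel (y : BrauerAlgebra R n δ)
    rw [hy, rightProj_diagram]
    split_ifs with h
    · obtain ⟨rfl, h⟩ := h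
      obtain rfl := LinkState.rel_injective h
      exact he _ _
    · exact zero_mul _
  exact this hx

end Projection

end Brauer

/-! ### The layers of a restricted Brauer algebra -/

namespace Brauer

open CategoryTheory CategoryTheory.Abelian NoncommTor

universe u

section Layers

variable {R : Type u} [CommRing R] {n : ℕ} {δ : R} {A : Subalgebra R (BrauerAlgebra R n δ)}
  {M' : ∀ t, Set (LinkState n t)} {G' : ∀ t, Subgroup (Equiv.Perm (Fin t))}
  (hA : ObtainedByRestriction A M' G')

theorem quotientMap_surjective {a b : ℤ} (hab : a ≤ b) :
    Function.Surjective (quotientMap hA hab) := by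
  intro x
  obtain ⟨x, rfl⟩ := Ideal.Quotient.mk_surjective x
  exact ⟨Ideal.Quotient.mk _ x, quotientMap_mk hA hab x⟩

theorem mk_mem_ker_quotientMap {a b : ℤ} (hab : a ≤ b) (x : A) :
    Ideal.Quotient.mk (idealLE hA a) x ∈ RingHom.ker (quotientMap hA hab) ↔
      x ∈ spanLE A M' G' b := by
  rw [RingHom.mem_ker, quotientMap_mk, Ideal.Quotient.eq_zero_iff_mem, mem_idealLE]

theorem exists_mk_eq {a b : ℤ} (hab : a ≤ b) (c : RingHom.ker (quotientMap hA hab)) :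
    ∃ x ∈ spanLE A M' G' b, Ideal.Quotient.mk (idealLE hA a) x = c := by
  obtain ⟨x, hx⟩ := Ideal.Quotient.mk_surjective c.1
  exact ⟨x, (mk_mem_ker_quotientMap hA hab x).1 (hx ▸ c.2), hx⟩

/-- Taking the component of right-hand side `s` is a linear endomorphism of the left ideal
`I_{≤ t} / I_{≤ t - 1}` of `A / I_{≤ t - 1}`. It is computed on representatives in `A`. -/
theorem exists_componentMap (t : ℕ) (hab : (t : ℤ) - 1 ≤ t) (s : Setoid (Fin n)) :
    ∃ π : RingHom.ker (quotientMap hA hab) →ₗ[A ⧸ idealLE hA (t - 1)]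
        RingHom.ker (quotientMap hA hab),
      ∀ (c : RingHom.ker (quotientMap hA hab)) (x y : A),
        Ideal.Quotient.mk _ x = c.1 →
        (y : BrauerAlgebra R n δ) = rightProj R δ t s x → Ideal.Quotient.mk _ y = (π c).1 := by
  choose r hr hrc using exists_mk_eq hA hab
  let ρ : RingHom.ker (quotientMap hA hab) → A := fun c => ⟨_, (rightProj_mem hA t s (hr c)).1⟩
  have hρ : ∀ c, Ideal.Quotient.mk (idealLE hA (t - 1)) (ρ c) ∈ RingHom.ker (quotientMap hA hab) :=
    fun c => (mk_mem_ker_quotientMap hA hab _).2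
      ((mem_spanLE_iff hA t _).2 (rightProj_mem hA t s (hr c)).2)
  -- the result does not depend on the representative
  have key : ∀ (c : RingHom.ker (quotientMap hA hab)) (x y : A),
      Ideal.Quotient.mk (idealLE hA (t - 1)) x = c.1 →
      (y : BrauerAlgebra R n δ) - rightProj R δ t s x ∈ ambientLE R n δ (t - 1) →
      Ideal.Quotient.mk (idealLE hA (t - 1)) y = Ideal.Quotient.mk _ (ρ c) := by
    intro c x y hx hy
    have h1 : x - r c ∈ spanLE A M' G' (t - 1) := (Ideal.Quotient.eq).1 (hx.trans (hrc c).symm)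
    have h2 := rightProj_eq_zero s (show (t : ℤ) - 1 < t by omega)
      ((mem_spanLE_iff hA _ _).1 h1)
    rw [AddSubgroupClass.coe_sub, map_sub, sub_eq_zero] at h2
    rw [h2] at hy
    exact (Ideal.Quotient.eq).2 ((mem_spanLE_iff hA _ _).2 hy)
  refine ⟨{ toFun := fun c => ⟨_, hρ c⟩, map_add' := fun c d => Subtype.ext ?_,
            map_smul' := fun b c => Subtype.ext ?_ }, fun c x y hx hy => ?_⟩
  · refine (key (c + d) (r c + r d) (ρ c + ρ d) ?_ ?_).symm
    · rw [map_add, hrc, hrc]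
      rfl
    · change rightProj R δ t s (r c) + rightProj R δ t s (r d) -
        rightProj R δ t s (r c + r d) ∈ _
      rw [← map_add, sub_self]
      exact zero_mem _
  · obtain ⟨b, rfl⟩ := Ideal.Quotient.mk_surjective b
    refine (key (Ideal.Quotient.mk _ b • c) (b * r c) (b * ρ c) ?_ ?_).symm
    · rw [map_mul, hrc]
      rfl
    · rw [← neg_mem_iff, neg_sub]
      exact rightProj_mul t s (b : BrauerAlgebra R n δ) _ ((mem_spanLE_iff hA _ _).1 (hr c))
  · exact key c x y hx (by rw [hy, sub_self]; exact zero_mem _)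

/-- Under Hypothesis (†) at `t`, the components of an element of `I_{≤ t} / I_{≤ t - 1}` for the
right-hand sides `q ∈ M' t` are its coordinates with respect to the right identities `e q`. -/
theorem hasDualBasis_quotientMap_nat {t : ℕ} (hdag : HypothesisDagger δ M' t)
    (hab : (t : ℤ) - 1 ≤ t) : HasDualBasis (quotientMap hA hab) := by
  have : Fintype (M' t) := Fintype.ofFinite _
  choose e heA het he using fun q : M' t => exists_right_identity hA hdag q.2
  choose π hπ using fun q : M' t => exists_componentMap hA t hab q.1.rel
  refine ⟨M' t, this, π, fun q => ⟨Ideal.Quotient.mk _ ⟨e q, heA q⟩,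
    (mk_mem_ker_quotientMap hA hab _).2 ((mem_spanLE_iff hA t _).2 (het q))⟩, fun c => ?_⟩
  obtain ⟨x, hx, hxc⟩ := exists_mk_eq hA hab c
  let y : M' t → A := fun q => ⟨_, (rightProj_mem hA t q.1.rel hx).1⟩
  have hy : ∀ q, Ideal.Quotient.mk _ (y q) = (π q c).1 := fun q => hπ q c x (y q) hxc rfl
  have hye : ∀ q, y q * ⟨e q, heA q⟩ = y q := fun q => Subtype.ext (rightProj_mul_eq (he q) hx)
  refine Subtype.ext ?_
  rw [AddSubmonoidClass.coe_finsetSum]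
  have hterm : ∀ q, (π q c : A ⧸ idealLE hA (t - 1)) * Ideal.Quotient.mk _ ⟨e q, heA q⟩ =
      Ideal.Quotient.mk _ (y q) := fun q => by rw [← hy, ← map_mul, hye]
  refine Eq.trans ?_ (Finset.sum_congr rfl fun q _ => (hterm q).symm)
  rw [← map_sum, ← hxc]
  refine (Ideal.Quotient.eq).2 ((mem_spanLE_iff hA _ _).2 ?_)
  have h := sub_sum_rightProj_mem t hx
  rw [AddSubgroupClass.coe_sub, AddSubmonoidClass.coe_finsetSum]
  exact h

/-- The kernel of a one-step quotient map has a dual basis. In negative degrees the kernel is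
zero. -/
theorem hasDualBasis_quotientMap {a c : ℤ} (hac : a ≤ c) (hc : c = a + 1)
    (hdag : ∀ t : ℕ, (t : ℤ) = c → HypothesisDagger δ M' t) :
    HasDualBasis (quotientMap hA hac) := by
  obtain rfl : a = c - 1 := by omega
  rcases le_or_gt 0 c with h0 | h0
  · lift c to ℕ using h0
    exact hasDualBasis_quotientMap_nat hA (hdag c rfl) hac
  · refine ⟨Empty, inferInstance, nofun, nofun, fun z => ?_⟩
    obtain ⟨x, hx, hxc⟩ := exists_mk_eq hA hac z
    have h1 : {x : A | ∃ t : ℕ, (t : ℤ) ≤ c ∧ ∃ p ∈ M' t, ∃ σ ∈ G' t, ∃ q ∈ M' t,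
        (x : BrauerAlgebra R n δ) = BrauerAlgebra.of R δ (LinkState.diagram p σ q)} = ∅ :=
      Set.eq_empty_iff_forall_notMem.2 fun x ⟨t, ht, _⟩ => by omega
    rw [spanLE, h1, Submodule.span_empty, Submodule.mem_bot] at hx
    refine Subtype.ext ?_
    rw [← hxc, hx, map_zero]
    rfl

/-- The projective modules over `A / I_{≤ b}` are acyclic over `A / I_{≤ a}`. -/
theorem extAcyclic_quotientMap {a b : ℤ} (hab : a ≤ b) (hb : b ≤ (n : ℤ) - 1)
    (hdag : ∀ t : ℕ, a < (t : ℤ) → (t : ℤ) ≤ b → HypothesisDagger δ M' t)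
    (N : ModuleCat.{u} (A ⧸ idealLE hA b)) [Projective N] :
    ExtAcyclic (charDual (quotientAugmentation hA a (hab.trans hb)))
      ((ModuleCat.restrictScalars (quotientMap hA hab : _ →+* _)).obj N) := by
  induction b, hab using Int.leInduction with
  | base =>
    have hid : ((quotientMap hA (le_refl a) : _ →ₐ[R] _) : _ →+* _) =
        RingHom.id (A ⧸ idealLE hA a) := RingHom.ext fun x => by
      obtain ⟨x, rfl⟩ := Ideal.Quotient.mk_surjective x
      exact quotientMap_mk hA le_rfl x
    rw [hid]
    exact ExtAcyclic.of_projective.of_iso (ModuleCat.restrictScalarsId'App _ rfl N)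
  | succ c hac ih =>
    have hc : c ≤ c + 1 := by omega
    have hcomp : quotientMap hA (hac.trans hc) = (quotientMap hA hc).comp (quotientMap hA hac) :=
      AlgHom.ext fun x => by
        obtain ⟨x, rfl⟩ := Ideal.Quotient.mk_surjective x
        rw [AlgHom.comp_apply, quotientMap_mk, quotientMap_mk, quotientMap_mk]
    have haug := augmentation_comp_quotientMap hA (hac.trans hc) hb
    rw [hcomp] at haug ⊢
    exact extAcyclic_comp (hasDualBasis_quotientMap hA hc rfl fun t ht => hdag t (by omega) ht.le)
      haug (quotientMap_surjective hA hac) (quotientMap_surjective hA hc)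
      (fun N _ => ih (hc.trans hb) (fun t h1 h2 => hdag t h1 (by omega)) N) N

end Layers

end Brauer

theorem mainTheorem6 {R : Type*} [CommRing R] (n : ℕ) (δ : R)
    (A : Subalgebra R (Brauer.BrauerAlgebra R n δ))
    (M' : ∀ t : ℕ, Set (Brauer.LinkState n t))
    (G' : ∀ t : ℕ, Subgroup (Equiv.Perm (Fin t)))
    (hA : Brauer.ObtainedByRestriction A M' G')
    (a b : ℤ) (hab : a ≤ b) (hb : b ≤ (n : ℤ) - 1)
    (hdag : ∀ t : ℕ, a < (t : ℤ) → (t : ℤ) ≤ b → Brauer.HypothesisDagger δ M' t) (i : ℕ) :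
    CategoryTheory.IsIso (Brauer.quotientTorMap hA hab hb i) := by
  exact NoncommTor.isIso_trivialMap (Brauer.augmentation_comp_quotientMap hA hab hb)
    (Brauer.quotientMap_surjective hA hab)
    (fun N _ => Brauer.extAcyclic_quotientMap hA hab hb hdag N) i
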